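/- **Setting.** A sublinear expectation space $(\Omega,\mathcal H,\hat{\mathbb E})$ consists of a set $\Omega$, a linear space $\mathcal H$ of real functions on $\Omega$ with $\varphi(X_1,\dots,X_n)\in\mathcal H$ whenever $X_1,\dots,X_n\in\mathcal H$ and $\varphi\in C_{b,Lip}(\mathbb R^n)$ (bounded Lipschitz functions), and a functional $\hat{\mathbb E}:\mathcal H\to\mathbb R$ that is monotone, constant preserving, subadditive and positively homogeneous. A random variable $X$ with values in $\mathbb R^m$ is a map $X:\Omega\to\mathbb R^m$ with $\varphi(X)\in\mathcal H$ for all $\varphi\in C_{b,Lip}(\mathbb R^m)$. Two random variables $X,Y$ (possibly on different spaces) have the same law if their expectations of $\varphi(X)$ and $\varphi(Y)$ agree for all such $\varphi$. $Y$ is independent from $X$ if $(X,Y)$ is a random variable and $\hat{\mathbb E}[\varphi(X,Y)]=\hat{\mathbb E}\big[\hat{\mathbb E}[\varphi(x,Y)]_{x=X}\big]$ for all bounded Lipschitz $\varphi$. $X_n\to X$ in distribution means that the expectations of $\varphi(X_n)$ converge to that of $\varphi(X)$ for all bounded Lipschitz $\varphi$. For $f\ge0$ unbounded, $\hat{\mathbb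 E}[f(X)]\in[0,\infty]$ denotes the supremum of $\hat{\mathbb E}[\varphi(X)]$ over bounded Lipschitz $\varphi\le f$. Let $\alpha\in(0,1]$ and let $Z_1,Z_2,\dots$ be $\mathbb R^d$-valued random variables on $(\Omega,\mathcal H,\hat{\mathbb E})$ which are i.i.d., i.e. $Z_{i+1}$ has the law of $Z_i$ and is independent from $(Z_1,\dots,Z_i)$ for each $i\ge1$. Put $S_n=\sum_{i=1}^nZ_i$. Consider: * (A1) for some $0<\delta<\alpha$, $\ \sup_{n\ge1}\hat{\mathbb E}\big[|n^{-1/\alpha}S_n|^\delta\big]<\infty$. * (A2) for some $0<\underline\Lambda<\overline\Lambda$ and every $\varphi\in C_b^3(\mathbb R^d)$ (bounded, with bounded continuous derivatives up to order 3) there is a function $l$ with $l(s)\to0$ as $s\downarrow0$ such that for all $s\in(0,1]$ and $x\in\mathbb R^d$ $$\frac1s\Big|\hat{\mathbb E}\big[\varphi(x+s^{1/\alpha}Z_1)-\varphi(x)\big]-s\sup_{F\in\mathcal L}\int_{\mathbb R^d}\delta^\alpha_\lambda\varphi(x)\,F(d\lambda)\Big|\le l(s),$$ where $\delta^\alpha_\lambda\varphi(x)=\varphi(x+\lambda)-\varphi(x)$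 if $\alpha<1$, $\delta^1_\lambda\varphi(x)=\varphi(x+\lambda)-\varphi(x)-\langle D\varphi(x),\lambda\mathbf 1_{\{|\lambda|\le1\}}\rangle$, and $\mathcal L$ is the set of the measures $F_\mu(B)=\int_S\mu(dz)\int_0^\infty\mathbf 1_B(rz)\,r^{-1-\alpha}dr$ with $\mu$ a symmetric finite measure on the unit sphere $S$ and $\mu(S)\in(\underline\Lambda,\overline\Lambda)$. Let $\tilde\Omega=D_0^d[0,1]$ be the space of càdlàg paths $\omega:[0,1]\to\mathbb R^d$ with $\omega_0=0$, $\tilde\zeta_t(\omega)=\omega_t$ the canonical process, and $Lip(\tilde\Omega)$ the set of all $\varphi(\tilde\zeta_{t_1},\tilde\zeta_{t_2}-\tilde\zeta_{t_1},\dots,\tilde\zeta_{t_n}-\tilde\zeta_{t_{n-1}})$ with $n\ge1$, $0\le t_1<\dots<t_n\le1$ and $\varphi\in C_{b,Lip}(\mathbb R^{d\times n})$. A càdlàg process $(X_t)_{t\in[0,1]}$ of random variables with $X_0=0$ is a nonlinear Lévy process if, for all $0\le s\le t\le1$, $X_t-X_s$ has the law of $X_{t-s}$ and is independent from $(X_{t_1},\dots,X_{t_n})$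 for all $0\le t_1\le\dots\le t_n\le s$. Call a functional $\tilde{\mathbb E}$ on $Lip(\tilde\Omega)$ a *Lévy limit along* a sequence $n_1<n_2<\cdots$ if $(\tilde\Omega,Lip(\tilde\Omega),\tilde{\mathbb E})$ is a sublinear expectation space on which $(\tilde\zeta_t)_{t\in[0,1]}$ is a nonlinear Lévy process, and $n_i^{-1/\alpha}S_{n_i}\to\tilde\zeta_1$ in distribution as $i\to\infty$. **Theorem.** Assume (A1). 1. Every strictly increasing sequence of indices has a subsequence along which there is a Lévy limit $\tilde{\mathbb E}$. 2. If the limit law is unique, i.e. if any two Lévy limits, along any two strictly increasing sequences of indices, give $\tilde\zeta_1$ the same law, then there is a Lévy limit $\tilde{\mathbb E}$ along the full sequence $n=1,2,\dots$; that is, $n^{-1/\alpha}S_n\to\tilde\zeta_1$ in distribution. 3. If (A2) holds as well, then there is a Lévy limit $\tilde{\mathbb E}$ along the full sequence. -/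

import Mathlib

open MeasureTheory Filter Topology Set
open scoped unitInterval

noncomputable section

namespace RobustStable

/-! ### Sublinear expectation spaces without integrability -/

/-- Membership in `C_{b,Lip}(V)`: bounded and (globally) Lipschitz functions. On a finite product
the maximum metric is used; it has the same Lipschitz functions as the Euclidean one. -/
def IsBddLip {V : Type*} [PseudoEMetricSpace V] (φ : V → ℝ) : Prop :=
  (∃ C : ℝ, ∀ x, |φ x| ≤ C) ∧ ∃ K : NNReal, LipschitzWith K φ

/-- `(Ω, H, E)` is a sublinear expectation space: `H` is a linear space of real functions on `Ω`,
closed under `φ(X₁, …, Xₙ)` with `φ ∈ C_{b,Lip}(ℝⁿ)`, and `E` is monotone, constant preserving,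
subadditive and positively homogeneous on `H`. The values of `E` outside `H` play no role. -/
structure IsSublinearExpectationSpace {Ω : Type*} (H : Set (Ω → ℝ)) (E : (Ω → ℝ) → ℝ) :
    Prop where
  zero_mem : (fun _ => 0) ∈ H
  add_mem : ∀ X ∈ H, ∀ Y ∈ H, (fun ω => X ω + Y ω) ∈ H
  smul_mem : ∀ (c : ℝ), ∀ X ∈ H, (fun ω => c * X ω) ∈ H
  comp_mem : ∀ (n : ℕ) (X : Fin n → Ω → ℝ), (∀ i, X i ∈ H) →
    ∀ φ : (Fin n → ℝ) → ℝ, IsBddLip φ → (fun ω => φ (fun i => X i ω)) ∈ H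
  mono : ∀ X ∈ H, ∀ Y ∈ H, (∀ ω, Y ω ≤ X ω) → E Y ≤ E X
  const : ∀ c : ℝ, E (fun _ => c) = c
  subadd : ∀ X ∈ H, ∀ Y ∈ H, E (fun ω => X ω + Y ω) ≤ E X + E Y
  pos_homog : ∀ (c : ℝ), 0 < c → ∀ X ∈ H, E (fun ω => c * X ω) = c * E X

/-- A `V`-valued random variable: all its bounded Lipschitz functionals belong to `H` (its
components themselves need not). -/
def IsRandomVariable {Ω V : Type*} [PseudoEMetricSpace V] (H : Set (Ω → ℝ)) (X : Ω → V) : Prop :=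
  ∀ φ : V → ℝ, IsBddLip φ → (fun ω => φ (X ω)) ∈ H

/-- `X` (under `E₁`) and `Y` (under `E₂`) are identically distributed. -/
def SameLaw {Ω₁ Ω₂ V : Type*} [PseudoEMetricSpace V]
    (E₁ : (Ω₁ → ℝ) → ℝ) (X : Ω₁ → V) (E₂ : (Ω₂ → ℝ) → ℝ) (Y : Ω₂ → V) : Prop :=
  ∀ φ : V → ℝ, IsBddLip φ → E₁ (fun ω => φ (X ω)) = E₂ (fun ω => φ (Y ω))

/-- `Y` is independent from `X`: `E[φ(X, Y)] = E[E[φ(x, Y)]_{x = X}]`. -/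
structure IsIndependentFrom {Ω V W : Type*} [PseudoEMetricSpace V] [PseudoEMetricSpace W]
    (H : Set (Ω → ℝ)) (E : (Ω → ℝ) → ℝ) (Y : Ω → W) (X : Ω → V) : Prop where
  joint : IsRandomVariable H (fun ω => (X ω, Y ω))
  eq : ∀ φ : V × W → ℝ, IsBddLip φ →
    E (fun ω => φ (X ω, Y ω)) = E (fun ω => E (fun ω' => φ (X ω, Y ω')))

/-- `Xₙ` (under `E`) converges in distribution to `X` (under `E'`). -/
def ConvergesInLaw {Ω Ω' V : Type*} [PseudoEMetricSpace V]
    (E : (Ω → ℝ) → ℝ) (X : ℕ → Ω → V) (E' : (Ω' → ℝ) → ℝ) (Y : Ω' → V) : Prop :=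
  ∀ φ : V → ℝ, IsBddLip φ →
    Tendsto (fun n => E (fun ω => φ (X n ω))) atTop (𝓝 (E' (fun ω => φ (Y ω))))

/-- The extended-real value `E[f(X)]` of a possibly unbounded `f`, whose composition with `X` need
not belong to `H`: the supremum of `E[φ(X)]` over the bounded Lipschitz minorants `φ` of `f`. -/
def extExpectation {Ω V : Type*} [PseudoEMetricSpace V]
    (E : (Ω → ℝ) → ℝ) (f : V → ℝ) (X : Ω → V) : EReal :=
  ⨆ (φ : V → ℝ) (_ : IsBddLip φ) (_ : ∀ x, φ x ≤ f x), ((E (fun ω => φ (X ω)) : ℝ) : EReal)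

/-! ### The i.i.d. sequence, its normalized sums and the two conditions -/

/-- `ℝ^d` with the Euclidean norm. -/
abbrev Vec (d : ℕ) : Type := EuclideanSpace ℝ (Fin d)

/-- An i.i.d. sequence (indexed from `0`): `Z_{i+1}` has the law of `Z_i` and is independent from
`(Z_0, …, Z_i)`. -/
structure IsIID {Ω : Type*} {d : ℕ} (H : Set (Ω → ℝ)) (E : (Ω → ℝ) → ℝ) (Z : ℕ → Ω → Vec d) :
    Prop where
  randomVariable : ∀ i, IsRandomVariable H (Z i)
  sameLaw : ∀ i, SameLaw E (Z (i + 1)) E (Z i)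
  indep : ∀ i, IsIndependentFrom H E (Z (i + 1)) (fun ω (j : Fin (i + 1)) => Z j ω)

/-- The normalized sum `n^{-1/α} Sₙ`, where `Sₙ` is the sum of the first `n` variables. -/
def normSum {Ω : Type*} {d : ℕ} (α : ℝ) (Z : ℕ → Ω → Vec d) (n : ℕ) (ω : Ω) : Vec d :=
  ((n : ℝ) ^ (-(1 / α))) • ∑ i ∈ Finset.range n, Z i ω

/-- The `δ`-moment condition: for some `0 < δ < α`, `sup_{n ≥ 1} E[|n^{-1/α} Sₙ|^δ] < ∞`. -/
def MomentCondition {Ω : Type*} {d : ℕ} (E : (Ω → ℝ) → ℝ) (α : ℝ) (Z : ℕ → Ω → Vec d) : Prop :=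
  ∃ δ : ℝ, 0 < δ ∧ δ < α ∧
    (⨆ (n : ℕ) (_ : 1 ≤ n), extExpectation E (fun x : Vec d => ‖x‖ ^ δ) (normSum α Z n)) < ⊤

/-- The `α`-stable Lévy measure
`F_μ(B) = ∫_S μ(dz) ∫_0^∞ 1_B(r z) r^{-1-α} dr` of a measure `μ` on the unit sphere `S`: the image
of `μ(dz) ⊗ r^{-1-α} dr` under `(z, r) ↦ r z`. -/
def stableLevyMeasure {d : ℕ} (α : ℝ) (μ : Measure (Metric.sphere (0 : Vec d) 1)) :
    Measure (Vec d) :=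
  (μ.prod ((volume.restrict (Ioi (0 : ℝ))).withDensity
    (fun r => ENNReal.ofReal (r ^ (-(1 + α)))))).map (fun p => p.2 • (p.1 : Vec d))

/-- The jump uncertainty set: the measures `F_μ` with `μ` a symmetric finite measure on the unit
sphere whose total mass lies in the open interval `(Λ₁, Λ₂)`. -/
def jumpUncertaintySet (d : ℕ) (α Λ₁ Λ₂ : ℝ) : Set (Measure (Vec d)) :=
  {F | ∃ μ : Measure (Metric.sphere (0 : Vec d) 1), IsFiniteMeasure μ ∧
    μ.map (fun z => -z) = μ ∧ μ.real univ ∈ Ioo Λ₁ Λ₂ ∧ F = stableLevyMeasure α μ}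

/-- `C_b^3(ℝ^d)`: bounded functions with bounded continuous derivatives up to order `3`. -/
def IsCb3 {d : ℕ} (φ : Vec d → ℝ) : Prop :=
  ContDiff ℝ 3 φ ∧ ∀ k : ℕ, k ≤ 3 → ∃ C : ℝ, ∀ x, ‖iteratedFDeriv ℝ k φ x‖ ≤ C

open Classical in
/-- The difference operator `δ_λ^α φ(x)`, compensated at the small jumps when `α = 1`. -/
def jumpDiff {d : ℕ} (α : ℝ) (φ : Vec d → ℝ) (x l : Vec d) : ℝ :=
  if α = 1 then φ (x + l) - φ x - fderiv ℝ φ x (if ‖l‖ ≤ 1 then l else 0)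
  else φ (x + l) - φ x

/-- `sup_{F_μ} ∫ δ_λ^α φ(x) F_μ(dλ)` over the jump uncertainty set. -/
def jumpGenerator {d : ℕ} (α Λ₁ Λ₂ : ℝ) (φ : Vec d → ℝ) (x : Vec d) : ℝ :=
  sSup ((fun F : Measure (Vec d) => ∫ l, jumpDiff α φ x l ∂F) '' jumpUncertaintySet d α Λ₁ Λ₂)

/-- The consistency condition: for each `φ ∈ C_b^3(ℝ^d)`, uniformly in `x`,
`s⁻¹ |E[φ(x + s^{1/α} Z) - φ(x)] - s sup_{F_μ} ∫ δ_λ^α φ(x) F_μ(dλ)| ≤ l(s) → 0` as `s → 0`. -/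
def ConsistencyCondition {Ω : Type*} {d : ℕ} (E : (Ω → ℝ) → ℝ) (α Λ₁ Λ₂ : ℝ) (Z : Ω → Vec d) :
    Prop :=
  ∀ φ : Vec d → ℝ, IsCb3 φ → ∃ l : ℝ → ℝ, Tendsto l (𝓝[>] 0) (𝓝 0) ∧
    ∀ s ∈ Ioc (0 : ℝ) 1, ∀ x : Vec d,
      (1 / s) * |E (fun ω => φ (x + (s ^ (1 / α)) • Z ω) - φ x) -
        s * jumpGenerator α Λ₁ Λ₂ φ x| ≤ l s

/-! ### The path space, its cylinder functionals and nonlinear Lévy processes -/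

/-- Càdlàg functions on `[0,1]`: right-continuous with left limits. -/
def IsCadlag {V : Type*} [TopologicalSpace V] (f : I → V) : Prop :=
  ∀ t : I, ContinuousWithinAt f (Ici t) t ∧ ∃ l : V, Tendsto f (𝓝[<] t) (𝓝 l)

/-- The path space `D_0^d[0,1]`: càdlàg paths in `ℝ^d` that start at `0`. -/
def PathSpace (d : ℕ) : Type := {f : I → Vec d // IsCadlag f ∧ f 0 = 0}

/-- The canonical process on the path space. -/
def canonical {d : ℕ} (t : I) (ω : PathSpace d) : Vec d := ω.1 t

/-- The vector `(ζ_{t_0}, ζ_{t_1} - ζ_{t_0}, …, ζ_{t_n} - ζ_{t_{n-1}})` of the canonical process. -/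
def increments {d n : ℕ} (t : Fin (n + 1) → I) (ω : PathSpace d) : Fin (n + 1) → Vec d :=
  Fin.cons (canonical (t 0) ω) (fun k : Fin n => canonical (t k.succ) ω - canonical (t k.castSucc) ω)

/-- The cylinder Lipschitz functionals `Lip(D_0^d[0,1])`. -/
def LipFunctionals (d : ℕ) : Set (PathSpace d → ℝ) :=
  {X | ∃ (n : ℕ) (t : Fin (n + 1) → I) (φ : (Fin (n + 1) → Vec d) → ℝ),
    StrictMono t ∧ IsBddLip φ ∧ X = fun ω => φ (increments t ω)}

/-- A nonlinear Lévy process over the time interval `[0,1]`. -/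
structure IsNonlinearLevy {Ω : Type*} {d : ℕ} (H : Set (Ω → ℝ)) (E : (Ω → ℝ) → ℝ)
    (X : I → Ω → Vec d) : Prop where
  randomVariable : ∀ t, IsRandomVariable H (X t)
  cadlag : ∀ ω, IsCadlag (fun t => X t ω)
  zero : ∀ ω, X 0 ω = 0
  /-- Stationary increments; here `r = t - s`. -/
  stationary : ∀ s t r : I, (s : ℝ) + r = t → SameLaw E (fun ω => X t ω - X s ω) E (X r)
  /-- Independent increments. -/
  indep : ∀ (n : ℕ) (u : Fin n → I) (s t : I), Monotone u → (∀ i, u i ≤ s) → s ≤ t →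
    IsIndependentFrom H E (fun ω => X t ω - X s ω) (fun ω i => X (u i) ω)

/-- `E'` is a sublinear expectation on the cylinder Lipschitz functionals of the path space, under
which the canonical process is a nonlinear Lévy process `ζ`, and the normalized sums along the
indices `k 0, k 1, …` converge in distribution to `ζ_1`. -/
structure IsLevyLimitAlong {Ω : Type*} {d : ℕ} (E : (Ω → ℝ) → ℝ) (α : ℝ) (Z : ℕ → Ω → Vec d)
    (k : ℕ → ℕ) (E' : (PathSpace d → ℝ) → ℝ) : Prop where
  sublinear : IsSublinearExpectationSpace (LipFunctionals d) E'
  levy : IsNonlinearLevy (LipFunctionals d) E' (canonical (d := d))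
  converges : ConvergesInLaw E (fun i => normSum α Z (k i)) E' (canonical (d := d) 1)

end RobustStable

end

namespace RobustStable

/-! ### Bounded Lipschitz functions -/

section BddLip

variable {V W : Type*} [PseudoMetricSpace V] [PseudoMetricSpace W]

/-! Write `X_n(t) = n^{-1/α} S_⌊nt⌋`; these step paths lie in the path space. For a cylinder
functional `F` the numbers `E[F(X_n)]` are bounded, so they converge along any ultrafilter `U` finer
than `atTop`; the limit defines `limitExpectation`. The axioms of a sublinear expectation pass to
the limit. No tightness in path space is needed, since only finitely many times enter a cylinder
functional and the canonical paths are càdlàg by definition.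

The analytic input is scaling: `n^{-1/α} S_k = (k/n)^{1/α} · k^{-1/α} S_k`, so (A1) bounds the
`δ`-moment of `X_n(k/n)` by `M (k/n)^{δ/α}` (`HasMomentBound.map_scaledSum_le`). Hence one summand
is negligible, the marginals are tight, and the limit is continuous in time at `0`. The increments
of `X_n` are exactly independent of the past, and stationary up to one summand from rounding.
Stationarity passes to the limit directly. For independence, the frozen expectations are
equi-Lipschitz, so they converge uniformly on balls, and the tails are small.

For part 1, `C_{b,Lip}` has a countable subset dense for bounded convergence uniform on balls, so a
diagonal extraction turns the ultrafilter limit at time 1 into a limit along a subsequence. Part 2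
is the subsequence principle.

For part 3 it is enough that all ultrafilter limits agree at time 1. By (A2) the difference
quotients of a `C_b^3` function are uniformly Cauchy as `s ↓ 0`; iterating the one-step expansion
shows that any two limit semigroups `T`, `T'` differ by `o(r)` at time `r`, uniformly in space. They
are compared without viscosity solutions. For a mollifier `ν`, Jensen's inequality gives `T_r((T_t
f) * ν) ≤ (T_{t+r} f) * ν`, so `(T_t f) * ν` is a smooth supersolution, on which `T_r` may be
exchanged for `T'_r`. Thus `sup (T'_t(f * ν) - (T_t f) * ν)` starts at `0` and has nonpositive right
derivative. Letting `ν` shrink to a point mass gives `T' f ≤ T f`, and symmetry gives equality. -/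

theorem isBddLip_of_le {φ : V → ℝ} {C K : ℝ} (hC : ∀ x, |φ x| ≤ C)
    (hK : ∀ x y, |φ x - φ y| ≤ K * dist x y) : IsBddLip φ := by
  refine ⟨⟨C, hC⟩, K.toNNReal, LipschitzWith.of_dist_le_mul fun x y => ?_⟩
  rw [Real.dist_eq]
  exact (hK x y).trans (mul_le_mul_of_nonneg_right (Real.le_coe_toNNReal K) dist_nonneg)

theorem IsBddLip.exists_bounds {φ : V → ℝ} (h : IsBddLip φ) :
    ∃ C K : ℝ, 0 ≤ C ∧ 0 ≤ K ∧ (∀ x, |φ x| ≤ C) ∧ ∀ x y, |φ x - φ y| ≤ K * dist x y := by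
  obtain ⟨⟨C, hC⟩, K, hK⟩ := h
  refine ⟨max C 0, K, le_max_right _ _, K.2, fun x => (hC x).trans (le_max_left _ _), fun x y => ?_⟩
  rw [← Real.dist_eq]
  exact hK.dist_le_mul x y

theorem IsBddLip.comp {φ : W → ℝ} (h : IsBddLip φ) {f : V → W} {K : NNReal}
    (hf : LipschitzWith K f) : IsBddLip (fun x => φ (f x)) := by
  obtain ⟨⟨C, hC⟩, K', hK'⟩ := h
  exact ⟨⟨C, fun x => hC _⟩, _, hK'.comp hf⟩

theorem isBddLip_const (c : ℝ) : IsBddLip (fun _ : V => c) :=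
  ⟨⟨|c|, fun _ => le_rfl⟩, 0, LipschitzWith.const c⟩

theorem IsBddLip.add {φ ψ : V → ℝ} (hφ : IsBddLip φ) (hψ : IsBddLip ψ) :
    IsBddLip (fun x => φ x + ψ x) := by
  obtain ⟨⟨C, hC⟩, K, hK⟩ := hφ
  obtain ⟨⟨C', hC'⟩, K', hK'⟩ := hψ
  exact ⟨⟨C + C', fun x => (abs_add_le _ _).trans (add_le_add (hC x) (hC' x))⟩, _, hK.add hK'⟩

theorem IsBddLip.const_mul {φ : V → ℝ} (hφ : IsBddLip φ) (c : ℝ) :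
    IsBddLip (fun x => c * φ x) := by
  obtain ⟨C, K, -, -, hC, hK⟩ := hφ.exists_bounds
  refine isBddLip_of_le (C := |c| * C) (K := |c| * K) (fun x => ?_) fun x y => ?_
  · rw [abs_mul]; exact mul_le_mul_of_nonneg_left (hC x) (abs_nonneg c)
  · rw [← mul_sub, abs_mul, mul_assoc]; exact mul_le_mul_of_nonneg_left (hK x y) (abs_nonneg c)

theorem IsBddLip.neg {φ : V → ℝ} (hφ : IsBddLip φ) : IsBddLip (fun x => -φ x) := by
  simpa using hφ.const_mul (-1)

theorem IsBddLip.sub {φ ψ : V → ℝ} (hφ : IsBddLip φ) (hψ : IsBddLip ψ) :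
    IsBddLip (fun x => φ x - ψ x) := by
  simpa [sub_eq_add_neg] using hφ.add hψ.neg

theorem IsBddLip.comp_left {W : Type*} [SeminormedAddCommGroup W] {φ : W → ℝ} (h : IsBddLip φ)
    (x : W) : IsBddLip (fun y => φ (x + y)) :=
  h.comp (LipschitzWith.of_dist_le_mul (K := 1) (f := fun y => x + y) fun a b => by simp)

theorem IsBddLip.comp_prodMk {φ : V × W → ℝ} (h : IsBddLip φ) (x : V) :
    IsBddLip (fun y => φ (x, y)) :=
  h.comp (LipschitzWith.prodMk_left x)

/-- The cutoff `min 1 (‖x‖ / R)`. -/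
noncomputable def cutoff {W : Type*} [SeminormedAddCommGroup W] (R : ℝ) (x : W) : ℝ :=
  min 1 (‖x‖ / R)

theorem cutoff_nonneg {W : Type*} [SeminormedAddCommGroup W] {R : ℝ} (hR : 0 < R) (x : W) :
    0 ≤ cutoff R x := le_min zero_le_one (by positivity)

theorem isBddLip_cutoff {W : Type*} [SeminormedAddCommGroup W] {R : ℝ} (hR : 0 < R) :
    IsBddLip (cutoff R : W → ℝ) := by
  refine isBddLip_of_le (C := 1) (K := R⁻¹) (fun x => ?_) fun x y => ?_
  · rw [abs_of_nonneg (cutoff_nonneg hR x)]; exact min_le_left _ _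
  · calc |min 1 (‖x‖ / R) - min 1 (‖y‖ / R)| ≤ max |(1 : ℝ) - 1| |‖x‖ / R - ‖y‖ / R| :=
          abs_min_sub_min_le_max _ _ _ _
      _ = |‖x‖ - ‖y‖| / R := by
          rw [sub_self, abs_zero, max_eq_right (abs_nonneg _), ← sub_div, abs_div, abs_of_pos hR]
      _ ≤ R⁻¹ * dist x y := by
          rw [div_eq_inv_mul, dist_eq_norm]
          exact mul_le_mul_of_nonneg_left (abs_norm_sub_norm_le x y) (by positivity)

/-- A bounded function that is small on a ball is dominated by a multiple of the cutoff. -/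
theorem abs_le_add_cutoff {W : Type*} [SeminormedAddCommGroup W] {f : W → ℝ} {C R ε : ℝ}
    (hR : 0 < R) (hε : 0 ≤ ε) (hC : ∀ x, |f x| ≤ C) (hf : ∀ x, ‖x‖ ≤ R → |f x| ≤ ε) (x : W) :
    |f x| ≤ ε + C * cutoff R x := by
  have hC0 : 0 ≤ C := (abs_nonneg _).trans (hC x)
  rcases le_total ‖x‖ R with h | h
  · exact (hf x h).trans (le_add_of_nonneg_right (mul_nonneg hC0 (cutoff_nonneg hR x)))
  · have : cutoff R x = 1 := min_eq_left ((one_le_div hR).2 h)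
    rw [this, mul_one]
    exact (hC x).trans (le_add_of_nonneg_left hε)

/-- Equi-Lipschitz functions converge uniformly on compact sets if they converge pointwise. -/
theorem eventually_uniform_of_equiLipschitz {ι : Type*} {F : Filter ι} {s : Set V}
    (hs : IsCompact s) {g : ι → V → ℝ} {g' : V → ℝ} {K : ℝ}
    (hg : ∀ i x y, |g i x - g i y| ≤ K * dist x y) (hg' : ∀ x y, |g' x - g' y| ≤ K * dist x y)
    (hlim : ∀ x, Tendsto (fun i => g i x) F (𝓝 (g' x))) {ε : ℝ} (hε : 0 < ε) :
    ∀ᶠ i in F, ∀ x ∈ s, |g i x - g' x| ≤ ε := by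
  have hη : 0 < ε / (4 * (|K| + 1)) := by positivity
  obtain ⟨t, -, htf, hst⟩ := hs.finite_cover_balls hη
  have hev : ∀ᶠ i in F, ∀ x ∈ t, |g i x - g' x| < ε / 2 := by
    rw [eventually_all_finite htf]
    intro x _
    have := (Metric.tendsto_nhds.1 (hlim x)) (ε / 2) (by positivity)
    simpa [Real.dist_eq] using this
  filter_upwards [hev] with i hi x hx
  obtain ⟨y, hy, hxy⟩ := mem_iUnion₂.1 (hst hx)
  rw [Metric.mem_ball] at hxy
  have hK : K * dist x y ≤ ε / 4 := by
    calc K * dist x y ≤ (|K| + 1) * dist x y :=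
          mul_le_mul_of_nonneg_right (by linarith [le_abs_self K]) dist_nonneg
      _ ≤ (|K| + 1) * (ε / (4 * (|K| + 1))) :=
          mul_le_mul_of_nonneg_left hxy.le (by positivity)
      _ = ε / 4 := by field_simp
  have h1 := abs_le.1 ((hg i x y).trans hK)
  have h2 := abs_le.1 ((hg' x y).trans hK)
  have h3 := abs_lt.1 (hi y hy)
  exact abs_le.2 ⟨by linarith, by linarith⟩

end BddLip

/-! ### Sublinear expectations -/

section Expectation

variable {Ω : Type*} {H : Set (Ω → ℝ)} {E : (Ω → ℝ) → ℝ}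

theorem IsSublinearExpectationSpace.const_mem (hE : IsSublinearExpectationSpace H E) (c : ℝ) :
    (fun _ => c) ∈ H :=
  hE.comp_mem 0 Fin.elim0 (fun i => i.elim0) (fun _ => c) (isBddLip_const c)

theorem IsSublinearExpectationSpace.map_add_const (hE : IsSublinearExpectationSpace H E)
    {X : Ω → ℝ} (hX : X ∈ H) (c : ℝ) : E (fun ω => X ω + c) = E X + c := by
  apply le_antisymm
  · have := hE.subadd X hX _ (hE.const_mem c)
    rwa [hE.const] at this
  · have := hE.subadd _ (hE.add_mem X hX _ (hE.const_mem c)) _ (hE.const_mem (-c))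
    simp only [add_neg_cancel_right, hE.const] at this
    linarith

theorem IsSublinearExpectationSpace.map_sub_const (hE : IsSublinearExpectationSpace H E)
    {X : Ω → ℝ} (hX : X ∈ H) (c : ℝ) : E (fun ω => X ω - c) = E X - c := by
  simpa [sub_eq_add_neg] using hE.map_add_const hX (-c)

theorem IsSublinearExpectationSpace.neg_le (hE : IsSublinearExpectationSpace H E) {X : Ω → ℝ}
    (hX : X ∈ H) : -E (fun ω => -X ω) ≤ E X := by
  have hX' : (fun ω => -X ω) ∈ H := by simpa using hE.smul_mem (-1) X hX
  have := hE.subadd X hX _ hX'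
  simp only [add_neg_cancel, hE.const] at this
  linarith

theorem IsSublinearExpectationSpace.map_le_map_add (hE : IsSublinearExpectationSpace H E)
    {X Y Z : Ω → ℝ} (hX : X ∈ H) (hY : Y ∈ H) (hZ : Z ∈ H) (h : ∀ ω, X ω ≤ Y ω + Z ω) :
    E X ≤ E Y + E Z :=
  (hE.mono _ (hE.add_mem Y hY Z hZ) X hX h).trans (hE.subadd Y hY Z hZ)

theorem IsSublinearExpectationSpace.abs_map_sub_le (hE : IsSublinearExpectationSpace H E)
    {X Y Z : Ω → ℝ} (hX : X ∈ H) (hY : Y ∈ H) (hZ : Z ∈ H) (h : ∀ ω, |X ω - Y ω| ≤ Z ω) :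
    |E X - E Y| ≤ E Z := by
  have h1 := hE.map_le_map_add hX hY hZ fun ω => by linarith [(abs_le.1 (h ω)).2]
  have h2 := hE.map_le_map_add hY hX hZ fun ω => by linarith [(abs_le.1 (h ω)).1]
  exact abs_le.2 ⟨by linarith, by linarith⟩

theorem IsSublinearExpectationSpace.abs_map_sub_le_const (hE : IsSublinearExpectationSpace H E)
    {X Y : Ω → ℝ} (hX : X ∈ H) (hY : Y ∈ H) {c : ℝ} (h : ∀ ω, |X ω - Y ω| ≤ c) :
    |E X - E Y| ≤ c := by
  simpa [hE.const] using hE.abs_map_sub_le hX hY (hE.const_mem c) h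

theorem IsSublinearExpectationSpace.abs_map_le (hE : IsSublinearExpectationSpace H E)
    {X : Ω → ℝ} (hX : X ∈ H) {c : ℝ} (h : ∀ ω, |X ω| ≤ c) : |E X| ≤ c := by
  simpa [hE.const] using hE.abs_map_sub_le_const hX (hE.const_mem 0) (c := c) (by simpa using h)

theorem IsSublinearExpectationSpace.sum_mem (hE : IsSublinearExpectationSpace H E) {ι : Type*}
    (s : Finset ι) {X : ι → Ω → ℝ} (hX : ∀ i ∈ s, X i ∈ H) : (fun ω => ∑ i ∈ s, X i ω) ∈ H := by
  classical
  induction s using Finset.induction_on with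
  | empty => simpa using hE.zero_mem
  | insert a s ha ih =>
    simp only [Finset.sum_insert ha]
    exact hE.add_mem _ (hX a (Finset.mem_insert_self a s)) _
      (ih fun i hi => hX i (Finset.mem_insert_of_mem hi))

theorem IsSublinearExpectationSpace.map_sum_le (hE : IsSublinearExpectationSpace H E) {ι : Type*}
    (s : Finset ι) {X : ι → Ω → ℝ} (hX : ∀ i ∈ s, X i ∈ H) :
    E (fun ω => ∑ i ∈ s, X i ω) ≤ ∑ i ∈ s, E (X i) := by
  classical
  induction s using Finset.induction_on with
  | empty => simp [hE.const]
  | insert a s ha ih =>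
    simp only [Finset.sum_insert ha]
    have hs : ∀ i ∈ s, X i ∈ H := fun i hi => hX i (Finset.mem_insert_of_mem hi)
    exact (hE.subadd _ (hX a (Finset.mem_insert_self a s)) _ (hE.sum_mem s hs)).trans
      (add_le_add_right (ih hs) _)

theorem IsSublinearExpectationSpace.map_const_mul (hE : IsSublinearExpectationSpace H E)
    {X : Ω → ℝ} (hX : X ∈ H) {c : ℝ} (hc : 0 ≤ c) : E (fun ω => c * X ω) = c * E X := by
  rcases hc.eq_or_lt with rfl | hc
  · simp [hE.const]
  · exact hE.pos_homog c hc X hX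

theorem IsRandomVariable.comp {V W : Type*} [PseudoMetricSpace V] [PseudoMetricSpace W]
    {X : Ω → V} (hX : IsRandomVariable H X) {f : V → W} {K : NNReal} (hf : LipschitzWith K f) :
    IsRandomVariable H (fun ω => f (X ω)) :=
  fun _ hφ => hX _ (hφ.comp hf)

/-- Freezing one variable and taking the expectation in the other one preserves `C_{b,Lip}`, with
the same bounds. -/
theorem IsSublinearExpectationSpace.bounds_map_prod (hE : IsSublinearExpectationSpace H E)
    {V W : Type*} [PseudoMetricSpace V] [PseudoMetricSpace W] {Y : Ω → W}
    (hY : IsRandomVariable H Y) {φ : V × W → ℝ} (hφ : IsBddLip φ) {C K : ℝ}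
    (hC : ∀ p, |φ p| ≤ C) (hK : ∀ p q, |φ p - φ q| ≤ K * dist p q) :
    (∀ x, |E (fun ω => φ (x, Y ω))| ≤ C) ∧
      ∀ x y, |E (fun ω => φ (x, Y ω)) - E (fun ω => φ (y, Y ω))| ≤ K * dist x y := by
  have hmem : ∀ x, (fun ω => φ (x, Y ω)) ∈ H := fun x => hY _ (hφ.comp_prodMk x)
  refine ⟨fun x => hE.abs_map_le (hmem x) fun ω => hC _, fun x y =>
    hE.abs_map_sub_le_const (hmem x) (hmem y) fun ω => ?_⟩
  simpa [Prod.dist_eq] using hK (x, Y ω) (y, Y ω)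

theorem IsSublinearExpectationSpace.isBddLip_map_prod (hE : IsSublinearExpectationSpace H E)
    {V W : Type*} [PseudoMetricSpace V] [PseudoMetricSpace W] {Y : Ω → W}
    (hY : IsRandomVariable H Y) {φ : V × W → ℝ} (hφ : IsBddLip φ) :
    IsBddLip (fun x => E (fun ω => φ (x, Y ω))) := by
  obtain ⟨C, K, -, -, hC, hK⟩ := hφ.exists_bounds
  obtain ⟨h1, h2⟩ := hE.bounds_map_prod hY hφ hC hK
  exact isBddLip_of_le h1 h2

end Expectation

/-! ### I.i.d. sequences -/

section IID

variable {Ω : Type*} {d : ℕ} {H : Set (Ω → ℝ)} {E : (Ω → ℝ) → ℝ} {Z : ℕ → Ω → Vec d}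

theorem IsIID.isRandomVariable_head (hE : IsSublinearExpectationSpace H E) (hZ : IsIID H E Z) :
    ∀ k : ℕ, IsRandomVariable H (fun ω (j : Fin k) => Z j ω)
  | 0 => fun φ _ => by
    have : (fun ω => φ (fun j : Fin 0 => Z j ω)) = fun _ => φ Fin.elim0 := by
      funext ω; congr 1; funext j; exact j.elim0
    rw [this]; exact hE.const_mem _
  | k + 1 => (hZ.indep k).joint.comp LipschitzWith.prod_fst

theorem IsIID.sameLaw_zero (hZ : IsIID H E Z) (k : ℕ) : SameLaw E (Z k) E (Z 0) := by
  induction k with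
  | zero => exact fun _ _ => rfl
  | succ k ih => exact fun φ hφ => (hZ.sameLaw k φ hφ).trans (ih φ hφ)

/-- The inner variable is replaced by `Z 0`, and `k = 0` is included: there the head is the empty
tuple and the outer expectation is that of a constant. -/
theorem IsIID.indep_head (hE : IsSublinearExpectationSpace H E) (hZ : IsIID H E Z) (k : ℕ)
    {φ : (Fin k → Vec d) × Vec d → ℝ} (hφ : IsBddLip φ) :
    E (fun ω => φ (fun j => Z j ω, Z k ω)) =
      E (fun ω => E (fun ω' => φ (fun j => Z j ω, Z 0 ω'))) := by
  have hlaw : ∀ y, E (fun ω' => φ (y, Z k ω')) = E (fun ω' => φ (y, Z 0 ω')) :=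
    fun y => hZ.sameLaw_zero k _ (hφ.comp_prodMk y)
  cases k with
  | zero =>
    have h0 : ∀ ω, (fun j : Fin 0 => Z j ω) = Fin.elim0 := fun ω => funext fun j => j.elim0
    simp only [h0, hE.const]
  | succ k => simpa only [hlaw] using (hZ.indep k).eq φ hφ

/-- The linear map `(y, z) ↦ ((y_0, …, y_{a-1}), y_a + ⋯ + y_{a+m-1} + z)`. -/
noncomputable def splitSum (d a m : ℕ) :
    ((Fin (a + m) → Vec d) × Vec d) →L[ℝ] ((Fin a → Vec d) × Vec d) :=
  (ContinuousLinearMap.pi fun j => (ContinuousLinearMap.proj (Fin.castAdd m j)).comp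
    (ContinuousLinearMap.fst ℝ (Fin (a + m) → Vec d) (Vec d))).prod
    ((∑ i : Fin m, (ContinuousLinearMap.proj (Fin.natAdd a i)).comp
      (ContinuousLinearMap.fst ℝ (Fin (a + m) → Vec d) (Vec d))) +
      ContinuousLinearMap.snd ℝ _ _)

theorem splitSum_apply (a m : ℕ) (Y : ℕ → Vec d) (z : Vec d) :
    splitSum d a m (fun j : Fin (a + m) => Y j, z) =
      (fun j : Fin a => Y j, (∑ i ∈ Finset.range m, Y (a + i)) + z) := by
  rw [Finset.sum_range]
  simp [splitSum]

theorem IsIID.isRandomVariable_split (hE : IsSublinearExpectationSpace H E) (hZ : IsIID H E Z)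
    (a m : ℕ) : IsRandomVariable H
      (fun ω => ((fun j : Fin a => Z j ω), ∑ i ∈ Finset.range m, Z (a + i) ω)) := by
  have h := (hZ.isRandomVariable_head hE (a + m)).comp
    ((splitSum d a m).lipschitz.comp (LipschitzWith.prodMk_right 0))
  have hs : ∀ ω, splitSum d a m (fun j : Fin (a + m) => Z j ω, 0) = _ :=
    fun ω => splitSum_apply a m (fun i => Z i ω) 0
  simpa only [Function.comp_apply, hs, add_zero] using h

theorem IsIID.isRandomVariable_sum (hE : IsSublinearExpectationSpace H E) (hZ : IsIID H E Z)
    (m : ℕ) : IsRandomVariable H (fun ω => ∑ i ∈ Finset.range m, Z i ω) := by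
  simpa using (hZ.isRandomVariable_split hE 0 m).comp LipschitzWith.prod_snd

theorem IsBddLip.comp_add_snd {V : Type*} [PseudoMetricSpace V] {W : Type*}
    [SeminormedAddCommGroup W] {ψ : V × W → ℝ} (hψ : IsBddLip ψ) :
    IsBddLip (fun p : (V × W) × W => ψ (p.1.1, p.1.2 + p.2)) :=
  hψ.comp ((LipschitzWith.prod_fst.comp LipschitzWith.prod_fst).prodMk
    ((LipschitzWith.prod_snd.comp LipschitzWith.prod_fst).add LipschitzWith.prod_snd))

/-- A block sum is independent from the past and distributed like the initial sum of the same
length. -/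
theorem IsIID.indep_block (hE : IsSublinearExpectationSpace H E) (hZ : IsIID H E Z) (a m : ℕ)
    {ψ : (Fin a → Vec d) × Vec d → ℝ} (hψ : IsBddLip ψ) :
    E (fun ω => ψ (fun j => Z j ω, ∑ i ∈ Finset.range m, Z (a + i) ω)) =
      E (fun ω => E (fun ω' => ψ (fun j => Z j ω, ∑ i ∈ Finset.range m, Z i ω'))) := by
  -- The last summand is integrated out first; the resulting function of the past and the shorter
  -- block is again bounded Lipschitz, so the induction hypothesis must cover all `ψ`. Then `h2`
  -- reassembles the initial sum by the same peeling with `a = 0`.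
  induction m generalizing ψ with
  | zero => simp [hE.const]
  | succ m ih =>
    have hs : ∀ a ω z, splitSum d a m (fun j : Fin (a + m) => Z j ω, z) = _ :=
      fun a ω z => splitSum_apply a m (fun i => Z i ω) z
    have hZ0 := hZ.randomVariable 0
    have hh : IsBddLip (fun p : (Fin a → Vec d) × Vec d => E (fun ω => ψ (p.1, p.2 + Z 0 ω))) :=
      hE.isBddLip_map_prod hZ0 hψ.comp_add_snd
    have h1 : E (fun ω => ψ (fun j => Z j ω, ∑ i ∈ Finset.range (m + 1), Z (a + i) ω)) =
        E (fun ω => E (fun ω' =>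
          ψ (fun j => Z j ω, (∑ i ∈ Finset.range m, Z (a + i) ω) + Z 0 ω'))) := by
      have := hZ.indep_head hE (a + m) (hψ.comp (splitSum d a m).lipschitz)
      simp only [hs] at this
      simpa only [Finset.sum_range_succ] using this
    have h2 : ∀ x : Fin a → Vec d,
        E (fun ω => E (fun ω' => ψ (x, (∑ i ∈ Finset.range m, Z i ω) + Z 0 ω'))) =
          E (fun ω => ψ (x, ∑ i ∈ Finset.range (m + 1), Z i ω)) := by
      intro x
      have hφ : IsBddLip (fun p : (Fin (0 + m) → Vec d) × Vec d => ψ (x, (splitSum d 0 m p).2)) :=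
        (hψ.comp_prodMk x).comp (LipschitzWith.prod_snd.comp (splitSum d 0 m).lipschitz)
      have := hZ.indep_head hE (0 + m) hφ
      simp only [hs] at this
      simpa only [Finset.sum_range_succ, zero_add] using this.symm
    rw [h1, ih hh]
    simp only [h2]

end IID

/-! ### Scaled partial sums and their moments -/

section Moments

variable {Ω : Type*} {d : ℕ} {H : Set (Ω → ℝ)} {E : (Ω → ℝ) → ℝ} {Z : ℕ → Ω → Vec d}

/-- The partial sum `n^{-1/α} S_k`. -/
noncomputable def scaledSum (α : ℝ) (Z : ℕ → Ω → Vec d) (n k : ℕ) (ω : Ω) : Vec d :=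
  ((n : ℝ) ^ (-(1 / α))) • ∑ i ∈ Finset.range k, Z i ω

theorem normSum_eq_scaledSum (α : ℝ) (Z : ℕ → Ω → Vec d) (n : ℕ) :
    normSum α Z n = scaledSum α Z n n := rfl

theorem lipschitzWith_smul_vec (c : ℝ) : LipschitzWith ‖c‖₊ (fun x : Vec d => c • x) :=
  LipschitzWith.of_dist_le_mul fun x y => by
    rw [dist_smul₀]; rfl

theorem IsIID.isRandomVariable_scaledSum (hE : IsSublinearExpectationSpace H E)
    (hZ : IsIID H E Z) (α : ℝ) (n k : ℕ) : IsRandomVariable H (scaledSum α Z n k) :=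
  (hZ.isRandomVariable_sum hE k).comp (lipschitzWith_smul_vec _)

/-- The map `y ↦ c • (y_0 + ⋯ + y_{m-1})`. -/
noncomputable def initialSum (d k m : ℕ) (c : ℝ) : (Fin k → Vec d) →L[ℝ] Vec d :=
  c • ∑ j ∈ (Finset.univ : Finset (Fin k)).filter (fun j : Fin k => (j : ℕ) < m),
    ContinuousLinearMap.proj j

theorem initialSum_apply {k m : ℕ} (hm : m ≤ k) (c : ℝ) (Y : ℕ → Vec d) :
    initialSum d k m c (fun j : Fin k => Y j) = c • ∑ i ∈ Finset.range m, Y i := by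
  have h : Finset.range m = (Finset.range k).filter (· < m) := by
    ext i; simp only [Finset.mem_range, Finset.mem_filter]; omega
  rw [h, Finset.sum_filter, Finset.sum_range, initialSum, Finset.sum_filter]
  simp only [smul_apply, sum_apply]
  congr 1
  refine Finset.sum_congr rfl fun j _ => ?_
  split_ifs <;> simp

theorem isRandomVariable_of_head {W : Type*} [PseudoMetricSpace W]
    (hE : IsSublinearExpectationSpace H E) (hZ : IsIID H E Z) {k : ℕ} {K : NNReal}
    {f : (Fin k → Vec d) → W} (hf : LipschitzWith K f) {X : Ω → W}
    (hX : ∀ ω, X ω = f (fun j => Z j ω)) : IsRandomVariable H X := by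
  have : X = fun ω => f (fun j => Z j ω) := funext hX
  rw [this]; exact (hZ.isRandomVariable_head hE k).comp hf

/-- Markov property of the random walk: the last `j` summands form a block independent of the first
`k`. -/
theorem IsIID.map_scaledSum_add (hE : IsSublinearExpectationSpace H E) (hZ : IsIID H E Z)
    (α : ℝ) (n k j : ℕ) {f : Vec d → ℝ} (hf : IsBddLip f) :
    E (fun ω => f (scaledSum α Z n (k + j) ω)) =
      E (fun ω => E (fun ω' => f (scaledSum α Z n k ω + scaledSum α Z n j ω'))) := by
  set c : ℝ := (n : ℝ) ^ (-(1 / α))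
  have hψ : IsBddLip (fun p : (Fin k → Vec d) × Vec d => f (initialSum d k k c p.1 + c • p.2)) :=
    hf.comp (((initialSum d k k c).lipschitz.comp LipschitzWith.prod_fst).add
      ((lipschitzWith_smul_vec c).comp LipschitzWith.prod_snd))
  have hs : ∀ ω, initialSum d k k c (fun j : Fin k => Z j ω) = _ :=
    fun ω => initialSum_apply le_rfl c (fun i => Z i ω)
  have := hZ.indep_block hE k j hψ
  simp only [hs] at this
  simpa only [scaledSum, Finset.sum_range_add, smul_add] using this

/-- `M` bounds the expectation of all bounded Lipschitz minorants of `‖x‖ ^ δ` under the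
normalized sums. -/
def HasMomentBound (E : (Ω → ℝ) → ℝ) (α : ℝ) (Z : ℕ → Ω → Vec d) (δ M : ℝ) : Prop :=
  ∀ n : ℕ, 1 ≤ n → ∀ φ : Vec d → ℝ, IsBddLip φ → (∀ x, φ x ≤ ‖x‖ ^ δ) →
    E (fun ω => φ (normSum α Z n ω)) ≤ M

theorem MomentCondition.exists_hasMomentBound {α : ℝ} (h : MomentCondition E α Z) :
    ∃ δ M : ℝ, 0 < δ ∧ δ < α ∧ HasMomentBound E α Z δ M := by
  obtain ⟨δ, h0, h1, h2⟩ := h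
  obtain ⟨M, hM, -⟩ := EReal.lt_iff_exists_real_btwn.1 h2
  refine ⟨δ, M, h0, h1, fun n hn φ hφ hle => ?_⟩
  have h3 : ((E (fun ω => φ (normSum α Z n ω)) : ℝ) : EReal) ≤
      ⨆ (n : ℕ) (_ : 1 ≤ n), extExpectation E (fun x : Vec d => ‖x‖ ^ δ) (normSum α Z n) := by
    refine le_iSup₂_of_le n hn ?_
    unfold extExpectation
    exact le_iSup_of_le φ (le_iSup₂_of_le hφ hle le_rfl)
  exact EReal.coe_le_coe_iff.1 (h3.trans hM.le)

variable {α δ M : ℝ}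

theorem HasMomentBound.nonneg (hE : IsSublinearExpectationSpace H E)
    (hM : HasMomentBound E α Z δ M) : 0 ≤ M := by
  have := hM 1 le_rfl (fun _ => 0) (isBddLip_const 0) fun x => by positivity
  rwa [hE.const] at this

/-- Apply the moment bound for `k^{-1/α} S_k` to `g(l y)` with `l = (k/n)^{1/α}`; the
`δ`-homogeneity of `‖y‖ ^ δ` produces the factor `l ^ δ`. For `k = 0` the sum vanishes and `g 0 ≤
0`. -/
theorem HasMomentBound.map_scaledSum_le (hE : IsSublinearExpectationSpace H E) (hZ : IsIID H E Z)
    (hα : 0 < α) (hδ : 0 < δ) (hM : HasMomentBound E α Z δ M) {n : ℕ} (hn : 1 ≤ n) (k : ℕ)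
    {g : Vec d → ℝ} (hg : IsBddLip g) {c : ℝ} (hc : 0 < c) (hgc : ∀ y, g y ≤ c * ‖y‖ ^ δ) :
    E (fun ω => g (scaledSum α Z n k ω)) ≤ c * M * ((k : ℝ) / n) ^ (δ / α) := by
  have hn0 : (0 : ℝ) < n := by exact_mod_cast hn
  rcases Nat.eq_zero_or_pos k with rfl | hk
  · have : (fun ω => g (scaledSum α Z n 0 ω)) = fun _ => g 0 := by
      funext ω; simp [scaledSum]
    rw [this, hE.const]
    have h0 : (0 : ℝ) ^ (δ / α) = 0 := Real.zero_rpow (by positivity)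
    simpa [h0, Real.zero_rpow hδ.ne'] using hgc 0
  · have hk0 : (0 : ℝ) < k := by exact_mod_cast hk
    set l : ℝ := (n : ℝ) ^ (-(1 / α)) * (k : ℝ) ^ (1 / α) with hl
    have hl0 : 0 < l := by positivity
    have hX : ∀ ω, scaledSum α Z n k ω = l • normSum α Z k ω := by
      intro ω
      rw [scaledSum, normSum, smul_smul, hl, mul_assoc, ← Real.rpow_add hk0]
      simp
    have hlδ : l ^ δ = ((k : ℝ) / n) ^ (δ / α) := by
      have : l = ((k : ℝ) / n) ^ (1 / α) := by
        rw [hl, Real.rpow_neg hn0.le, Real.div_rpow hk0.le hn0.le]; field_simp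
      rw [this, ← Real.rpow_mul (by positivity)]
      congr 1; field_simp
    have hc' : 0 < c * l ^ δ := by positivity
    have hφ : IsBddLip (fun y : Vec d => (c * l ^ δ)⁻¹ * g (l • y)) :=
      (hg.comp (lipschitzWith_smul_vec l)).const_mul _
    have h1 := hM k hk _ hφ fun y => by
      rw [inv_mul_le_iff₀ hc']
      refine (hgc _).trans (le_of_eq ?_)
      rw [norm_smul, Real.norm_of_nonneg hl0.le, Real.mul_rpow hl0.le (norm_nonneg _), mul_assoc]
    have hmem : (fun ω => g (scaledSum α Z n k ω)) ∈ H :=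
      hZ.isRandomVariable_scaledSum hE α n k _ hg
    simp only [← hX] at h1
    rw [hE.pos_homog _ (inv_pos.2 hc') _ hmem, inv_mul_le_iff₀ hc', hlδ] at h1
    linarith

/-- Since `δ ≤ 1`, `‖y‖ ^ δ` dominates `‖y‖` for `‖y‖ ≤ 1` (Lipschitz bound), and it is at least `1`
otherwise (sup bound). The `+ 1` keeps the constant positive, so that it can be divided by. -/
theorem abs_sub_le_mul_rpow {W : Type*} [SeminormedAddCommGroup W] {f : W → ℝ} {C K : ℝ}
    (hC0 : 0 ≤ C) (hK0 : 0 ≤ K) (hC : ∀ x, |f x| ≤ C) (hK : ∀ x y, |f x - f y| ≤ K * dist x y)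
    (hδ : 0 < δ) (hδ1 : δ ≤ 1) (x y : W) :
    |f (x + y) - f x| ≤ (2 * C + K + 1) * ‖y‖ ^ δ := by
  rcases le_total ‖y‖ 1 with h | h
  · have h1 : ‖y‖ ≤ ‖y‖ ^ δ := by
      rcases (norm_nonneg y).eq_or_lt with h0 | h0
      · rw [← h0]; positivity
      · simpa using Real.rpow_le_rpow_of_exponent_ge h0 h hδ1
    have h2 := hK (x + y) x
    rw [dist_eq_norm, add_sub_cancel_left] at h2
    calc |f (x + y) - f x| ≤ K * ‖y‖ := h2
      _ ≤ (2 * C + K + 1) * ‖y‖ ^ δ := by gcongr; linarith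
  · have h1 : 1 ≤ ‖y‖ ^ δ := Real.one_le_rpow h hδ.le
    calc |f (x + y) - f x| ≤ |f (x + y)| + |f x| := abs_sub _ _
      _ ≤ (2 * C + K + 1) * 1 := by linarith [hC (x + y), hC x]
      _ ≤ (2 * C + K + 1) * ‖y‖ ^ δ := by gcongr

/-- Both `f(x + ·) - f(x)` and its negative lie below a multiple of `‖·‖ ^ δ`; the lower estimate
uses `-E[-Y] ≤ E[Y]`. The bound is uniform in `x`. -/
theorem HasMomentBound.abs_map_sub_le (hE : IsSublinearExpectationSpace H E) (hZ : IsIID H E Z)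
    (hα : 0 < α) (hδ : 0 < δ) (hδ1 : δ ≤ 1) (hM : HasMomentBound E α Z δ M) {n : ℕ} (hn : 1 ≤ n)
    (k : ℕ) {f : Vec d → ℝ} {C K : ℝ} (hC0 : 0 ≤ C) (hK0 : 0 ≤ K) (hC : ∀ x, |f x| ≤ C)
    (hK : ∀ x y, |f x - f y| ≤ K * dist x y) (x : Vec d) :
    |E (fun ω => f (x + scaledSum α Z n k ω)) - f x| ≤
      (2 * C + K + 1) * M * ((k : ℝ) / n) ^ (δ / α) := by
  have hf : IsBddLip (fun y => f (x + y)) := (isBddLip_of_le hC hK).comp_left x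
  have hc : 0 < 2 * C + K + 1 := by positivity
  have hb := abs_sub_le_mul_rpow hC0 hK0 hC hK hδ hδ1 x
  have hX := hZ.isRandomVariable_scaledSum hE α n k
  have h1 := hM.map_scaledSum_le hE hZ hα hδ hn k (hf.sub (isBddLip_const (f x))) hc
    fun y => (le_abs_self _).trans (hb y)
  have h2 := hM.map_scaledSum_le hE hZ hα hδ hn k (hf.sub (isBddLip_const (f x))).neg hc
    fun y => (neg_le_abs _).trans (hb y)
  have h3 := hE.neg_le (hX _ (hf.sub (isBddLip_const (f x))))
  have h4 := hE.map_sub_const (hX _ hf) (f x)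
  exact abs_le.2 ⟨by linarith, by linarith⟩

/-- Markov's inequality, with the cutoff as a Lipschitz substitute for the indicator of `‖y‖ ≥ R`:
`min 1 a ≤ a ^ δ` for `a ≥ 0` and `δ ≤ 1`. -/
theorem HasMomentBound.map_cutoff_le (hE : IsSublinearExpectationSpace H E) (hZ : IsIID H E Z)
    (hα : 0 < α) (hδ : 0 < δ) (hδ1 : δ ≤ 1) (hM : HasMomentBound E α Z δ M) {n : ℕ} (hn : 1 ≤ n)
    (k : ℕ) {R : ℝ} (hR : 0 < R) :
    E (fun ω => cutoff R (scaledSum α Z n k ω)) ≤ R ^ (-δ) * M * ((k : ℝ) / n) ^ (δ / α) := by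
  refine hM.map_scaledSum_le hE hZ hα hδ hn k (isBddLip_cutoff hR) (by positivity) fun y => ?_
  rw [Real.rpow_neg hR.le, ← div_eq_inv_mul, ← Real.div_rpow (norm_nonneg y) hR.le]
  have h0 : 0 ≤ ‖y‖ / R := by positivity
  rcases le_total (‖y‖ / R) 1 with h | h
  · refine (min_le_right _ _).trans ?_
    rcases h0.eq_or_lt with h0 | h0
    · rw [← h0]; positivity
    · simpa using Real.rpow_le_rpow_of_exponent_ge h0 h hδ1
  · exact (min_le_left _ _).trans (Real.one_le_rpow h hδ.le)

theorem HasMomentBound.abs_map_shift_le (hE : IsSublinearExpectationSpace H E) (hZ : IsIID H E Z)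
    (hα : 0 < α) (hδ : 0 < δ) (hδ1 : δ ≤ 1) (hM : HasMomentBound E α Z δ M) {n : ℕ} (hn : 1 ≤ n)
    (k j : ℕ) {f : Vec d → ℝ} {C K : ℝ} (hC0 : 0 ≤ C) (hK0 : 0 ≤ K) (hC : ∀ x, |f x| ≤ C)
    (hK : ∀ x y, |f x - f y| ≤ K * dist x y) :
    |E (fun ω => f (scaledSum α Z n (k + j) ω)) - E (fun ω => f (scaledSum α Z n k ω))| ≤
      (2 * C + K + 1) * M * ((j : ℝ) / n) ^ (δ / α) := by
  have hf := isBddLip_of_le hC hK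
  rw [hZ.map_scaledSum_add hE α n k j hf]
  have hX := hZ.isRandomVariable_scaledSum hE α n
  have hg : IsBddLip (fun x => E (fun ω => f (x + scaledSum α Z n j ω))) :=
    hE.isBddLip_map_prod (φ := fun p : Vec d × Vec d => f (p.1 + p.2)) (hX j)
      (hf.comp (LipschitzWith.prod_fst.add LipschitzWith.prod_snd))
  exact hE.abs_map_sub_le_const (hX k _ hg) (hX k _ hf) fun ω =>
    hM.abs_map_sub_le hE hZ hα hδ hδ1 hn j hC0 hK0 hC hK _

end Moments

/-! ### Step paths and cylinder functionals -/

section Paths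

variable {Ω : Type*} {d : ℕ}

/-- The floor is constant just to the right of a point, and just to its left equal to the ceiling
minus one, so nothing is required of `g`. -/
theorem isCadlag_comp_floor {V : Type*} [TopologicalSpace V] (g : ℕ → V) {c : ℝ} (hc : 0 ≤ c) :
    IsCadlag (fun t : I => g ⌊c * (t : ℝ)⌋₊) := by
  intro t
  have hcont : Continuous (fun u : I => c * (u : ℝ)) := by fun_prop
  have hfloor : ∀ u : I, g ⌊c * (u : ℝ)⌋₊ = (fun z : ℤ => g z.toNat) ⌊c * (u : ℝ)⌋ := fun u => by
    simp only [Int.floor_toNat]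
  have key : ∀ {l : Filter I} {z : ℤ},
      Tendsto (fun u : I => ⌊c * (u : ℝ)⌋) l (pure z) →
        Tendsto (fun u : I => g ⌊c * (u : ℝ)⌋₊) l (𝓝 (g z.toNat)) := by
    intro l z h
    simp only [hfloor]
    exact ((tendsto_pure_pure (fun z : ℤ => g z.toNat) z).comp h).mono_right (pure_le_nhds _)
  constructor
  · have h : Tendsto (fun u : I => c * (u : ℝ)) (𝓝[≥] t) (𝓝[≥] (c * (t : ℝ))) :=
      tendsto_nhdsWithin_iff.2 ⟨hcont.continuousAt.mono_left nhdsWithin_le_nhds,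
        eventually_nhdsWithin_of_forall fun u (hu : t ≤ u) =>
          mul_le_mul_of_nonneg_left (Subtype.coe_le_coe.2 hu) hc⟩
    have := key ((tendsto_floor_right_pure_floor (c * (t : ℝ))).comp h)
    simpa only [ContinuousWithinAt, Int.floor_toNat] using this
  · rcases hc.eq_or_lt with rfl | hc
    · exact ⟨g 0, by simpa using tendsto_const_nhds⟩
    · have h : Tendsto (fun u : I => c * (u : ℝ)) (𝓝[<] t) (𝓝[<] (c * (t : ℝ))) :=
        tendsto_nhdsWithin_iff.2 ⟨hcont.continuousAt.mono_left nhdsWithin_le_nhds,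
          eventually_nhdsWithin_of_forall fun u (hu : u < t) =>
            mul_lt_mul_of_pos_left (Subtype.coe_lt_coe.2 hu) hc⟩
      exact ⟨_, key ((tendsto_floor_left_pure_ceil_sub_one (c * (t : ℝ))).comp h)⟩

/-- The path `t ↦ n^{-1/α} S_{⌊nt⌋}`. -/
noncomputable def stepPath (α : ℝ) (Z : ℕ → Ω → Vec d) (n : ℕ) (ω : Ω) : PathSpace d :=
  ⟨fun t => scaledSum α Z n ⌊(n : ℝ) * (t : ℝ)⌋₊ ω,
    isCadlag_comp_floor (fun k => scaledSum α Z n k ω) n.cast_nonneg, by simp [scaledSum]⟩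

theorem canonical_stepPath (α : ℝ) (Z : ℕ → Ω → Vec d) (n : ℕ) (ω : Ω) (t : I) :
    canonical t (stepPath α Z n ω) = scaledSum α Z n ⌊(n : ℝ) * (t : ℝ)⌋₊ ω := rfl

theorem floor_mul_le (n : ℕ) (t : I) : ⌊(n : ℝ) * (t : ℝ)⌋₊ ≤ n := by
  refine Nat.floor_le_of_le ?_
  exact mul_le_of_le_one_right n.cast_nonneg t.2.2

theorem lipschitzWith_reindex {ι κ W : Type*} [Fintype ι] [Fintype κ] [PseudoMetricSpace W]
    (f : ι → κ) : LipschitzWith 1 (fun (y : κ → W) i => y (f i)) :=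
  LipschitzWith.of_dist_le_mul fun x y => by
    rw [NNReal.coe_one, one_mul, dist_pi_le_iff dist_nonneg]
    exact fun i => dist_le_pi_dist x y (f i)

/-- The increments telescope, so values and increments of the path are Lipschitz functions of each
other. -/
theorem initialSum_increments {m : ℕ} (e : Fin (m + 1) → I) (ω : PathSpace d) (k : Fin (m + 1)) :
    initialSum d (m + 1) (k + 1) 1 (increments e ω) = canonical (e k) ω := by
  -- The index is clamped at `m` to extend the values to a sequence on `ℕ`; the terms beyond `m` do
  -- not enter.
  set b : ℕ → Vec d := fun j => canonical (e ⟨min j m, by omega⟩) ω with hb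
  set Y : ℕ → Vec d := fun j => if j = 0 then b 0 else b j - b (j - 1) with hY
  have hinc : increments e ω = fun j : Fin (m + 1) => Y j := by
    funext j
    refine Fin.cases ?_ (fun i => ?_) j
    · simp [increments, hY, hb]
    · have h1 : min (i : ℕ) m = i := min_eq_left (by omega)
      have h2 : min ((i : ℕ) + 1) m = i + 1 := min_eq_left (by omega)
      simp only [increments, Fin.cons_succ, hY, hb, Fin.val_succ, Nat.add_eq_zero_iff, one_ne_zero,
        and_false, if_false, Nat.add_sub_cancel, h1, h2]
      rfl
  have hsum : ∀ k : ℕ, ∑ i ∈ Finset.range (k + 1), Y i = b k := by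
    intro k
    induction k with
    | zero => simp [hY]
    | succ k ih => rw [Finset.sum_range_succ, ih]; simp [hY]
  rw [hinc, initialSum_apply (by omega), one_smul, hsum]
  have : min (k : ℕ) m = k := min_eq_left (by omega)
  simp [hb, this]

/-- Bounded Lipschitz functions of finitely many values of the canonical process are cylinder
functionals. -/
theorem mem_lipFunctionals {ι : Type*} [Fintype ι] (t : ι → I) {φ : (ι → Vec d) → ℝ}
    (hφ : IsBddLip φ) : (fun ω => φ (fun i => canonical (t i) ω)) ∈ LipFunctionals d := by
  classical
  -- Collecting the times in a finset sorts them and merges repetitions; inserting `0` provides the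
  -- one time that a cylinder functional needs, even for empty `ι`.
  set s : Finset I := insert 0 (Finset.univ.image t)
  obtain ⟨m, hm⟩ : ∃ m, s.card = m + 1 :=
    Nat.exists_eq_succ_of_ne_zero (Finset.card_ne_zero_of_mem (Finset.mem_insert_self 0 _))
  have hidx : ∀ i, ∃ k : Fin (m + 1), s.orderEmbOfFin hm k = t i := by
    intro i
    have : t i ∈ Set.range (s.orderEmbOfFin hm) := by
      rw [Finset.range_orderEmbOfFin]
      exact Finset.mem_coe.2
        (Finset.mem_insert_of_mem (Finset.mem_image_of_mem t (Finset.mem_univ i)))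
    exact this
  choose idx hidx using hidx
  refine ⟨m, s.orderEmbOfFin hm, fun y => φ (fun i => initialSum d (m + 1) (idx i + 1) 1 y),
    (s.orderEmbOfFin hm).strictMono, ?_, ?_⟩
  · exact hφ.comp (ContinuousLinearMap.pi fun i => initialSum d (m + 1) (idx i + 1) 1).lipschitz
  · funext ω
    simp only [initialSum_increments, hidx]

/-- Passing from increments to values frees the times from being ordered, so functionals with
different times can be combined over a sum of index types. -/
theorem exists_rep_of_mem_lipFunctionals {X : PathSpace d → ℝ} (hX : X ∈ LipFunctionals d) :
    ∃ (n : ℕ) (t : Fin n → I) (φ : (Fin n → Vec d) → ℝ), IsBddLip φ ∧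
      X = fun ω => φ (fun i => canonical (t i) ω) := by
  obtain ⟨n, t, φ, -, hφ, rfl⟩ := hX
  have hL : LipschitzWith 2 (fun y : Fin (n + 1) → Vec d => fun j : Fin (n + 1) =>
      (Fin.cons (y 0) (fun k : Fin n => y k.succ - y k.castSucc) : Fin (n + 1) → Vec d) j) := by
    refine LipschitzWith.of_dist_le_mul fun x y => ?_
    rw [dist_pi_le_iff (by positivity)]
    intro j
    refine Fin.cases ?_ (fun i => ?_) j
    · simp only [Fin.cons_zero]
      have := dist_le_pi_dist x y 0
      have h0 : 0 ≤ dist x y := dist_nonneg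
      push_cast; linarith
    · simp only [Fin.cons_succ]
      have h1 := dist_le_pi_dist x y i.succ
      have h2 := dist_le_pi_dist x y i.castSucc
      refine (dist_sub_sub_le _ _ _ _).trans ?_
      push_cast; linarith
  exact ⟨n + 1, t, _, hφ.comp hL, rfl⟩

theorem mem_lipFunctionals_of_comp {ι : Type*} [Fintype ι] {W : Type*} [PseudoMetricSpace W]
    (t : ι → I) {φ : W → ℝ} (hφ : IsBddLip φ) {f : (ι → Vec d) → W} {K : NNReal}
    (hf : LipschitzWith K f) :
    (fun ω => φ (f (fun i => canonical (t i) ω))) ∈ LipFunctionals d :=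
  mem_lipFunctionals t (hφ.comp hf)

end Paths

/-! ### The limit expectation along an ultrafilter -/

section LimitExpectation

variable {Ω : Type*} {d : ℕ} {H : Set (Ω → ℝ)} {E : (Ω → ℝ) → ℝ} {Z : ℕ → Ω → Vec d} {α : ℝ}
  {U : Ultrafilter ℕ}

/-- The limit of the laws of the step paths along an ultrafilter. -/
noncomputable def limitExpectation (E : (Ω → ℝ) → ℝ) (α : ℝ) (Z : ℕ → Ω → Vec d)
    (U : Ultrafilter ℕ) (F : PathSpace d → ℝ) : ℝ :=
  limUnder (U : Filter ℕ) (fun n => E (fun ω => F (stepPath α Z n ω)))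

/-- An ultrafilter on a compact interval converges, so `limUnder` is a genuine limit here. -/
theorem Ultrafilter.tendsto_limUnder_of_bounded {a : ℕ → ℝ} {C : ℝ} (h : ∀ n, |a n| ≤ C) :
    Tendsto a U (𝓝 (limUnder (U : Filter ℕ) a)) := by
  have hU : ((U.map a : Ultrafilter ℝ) : Filter ℝ) ≤ 𝓟 (Icc (-C) C) := by
    rw [Ultrafilter.coe_map, le_principal_iff]
    exact Filter.univ_mem' (f := (U : Filter ℕ)) fun n => abs_le.1 (h n)
  obtain ⟨x, -, hx⟩ := isCompact_Icc.ultrafilter_le_nhds _ hU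
  exact tendsto_nhds_limUnder ⟨x, hx⟩

theorem IsIID.isRandomVariable_values (hE : IsSublinearExpectationSpace H E) (hZ : IsIID H E Z)
    (α : ℝ) (n : ℕ) {ι : Type*} [Fintype ι] (k : ι → ℕ) :
    IsRandomVariable H (fun ω i => scaledSum α Z n (k i) ω) := by
  set N := ∑ i, k i
  have hk : ∀ i, k i ≤ N := fun i => Finset.single_le_sum (fun _ _ => Nat.zero_le _)
    (Finset.mem_univ i)
  refine isRandomVariable_of_head hE hZ (k := N)
    (ContinuousLinearMap.pi fun i => initialSum d N (k i) ((n : ℝ) ^ (-(1 / α)))).lipschitz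
    fun ω => funext fun i => ?_
  exact (initialSum_apply (hk i) _ fun i => Z i ω).symm

theorem IsIID.comp_stepPath_mem (hE : IsSublinearExpectationSpace H E) (hZ : IsIID H E Z)
    {F : PathSpace d → ℝ} (hF : F ∈ LipFunctionals d) (n : ℕ) :
    (fun ω => F (stepPath α Z n ω)) ∈ H := by
  obtain ⟨m, t, φ, hφ, rfl⟩ := exists_rep_of_mem_lipFunctionals hF
  exact hZ.isRandomVariable_values hE α n (fun i => ⌊(n : ℝ) * (t i : ℝ)⌋₊) φ hφ

theorem IsIID.tendsto_limitExpectation (hE : IsSublinearExpectationSpace H E) (hZ : IsIID H E Z)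
    {F : PathSpace d → ℝ} (hF : F ∈ LipFunctionals d) :
    Tendsto (fun n => E (fun ω => F (stepPath α Z n ω))) U (𝓝 (limitExpectation E α Z U F)) := by
  obtain ⟨m, t, φ, -, ⟨⟨C, hC⟩, -⟩, rfl⟩ := id hF
  exact Ultrafilter.tendsto_limUnder_of_bounded fun n =>
    hE.abs_map_le (hZ.comp_stepPath_mem hE hF n) fun ω => hC _

theorem IsIID.limitExpectation_values (hE : IsSublinearExpectationSpace H E) (hZ : IsIID H E Z)
    {ι : Type*} [Fintype ι] (t : ι → I) {φ : (ι → Vec d) → ℝ} (hφ : IsBddLip φ) :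
    Tendsto (fun n : ℕ => E (fun ω => φ (fun i => scaledSum α Z n ⌊(n : ℝ) * (t i : ℝ)⌋₊ ω))) U
      (𝓝 (limitExpectation E α Z U (fun ω => φ (fun i => canonical (t i) ω)))) :=
  hZ.tendsto_limitExpectation hE (mem_lipFunctionals t hφ)

theorem IsIID.tendsto_limitExpectation_canonical (hE : IsSublinearExpectationSpace H E)
    (hZ : IsIID H E Z) (t : I) {φ : Vec d → ℝ} (hφ : IsBddLip φ) :
    Tendsto (fun n : ℕ => E (fun ω => φ (scaledSum α Z n ⌊(n : ℝ) * (t : ℝ)⌋₊ ω))) U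
      (𝓝 (limitExpectation E α Z U (fun ω => φ (canonical t ω)))) :=
  hZ.limitExpectation_values hE (fun _ : Unit => t) (φ := fun y => φ (y ()))
    (hφ.comp (LipschitzWith.eval ()))

theorem IsIID.sublinear_limitExpectation (hE : IsSublinearExpectationSpace H E)
    (hZ : IsIID H E Z) (α : ℝ) (U : Ultrafilter ℕ) :
    IsSublinearExpectationSpace (LipFunctionals d) (limitExpectation E α Z U) := by
  have hconst : ∀ c : ℝ, (fun _ => c) ∈ LipFunctionals d := fun c =>
    mem_lipFunctionals (ι := Empty) (fun i => i.elim) (isBddLip_const c)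
  have hadd : ∀ X ∈ LipFunctionals d, ∀ Y ∈ LipFunctionals d,
      (fun ω => X ω + Y ω) ∈ LipFunctionals d := by
    intro X hX Y hY
    obtain ⟨n, t, φ, hφ, rfl⟩ := exists_rep_of_mem_lipFunctionals hX
    obtain ⟨m, s, ψ, hψ, rfl⟩ := exists_rep_of_mem_lipFunctionals hY
    exact mem_lipFunctionals (Sum.elim t s)
      ((hφ.comp (lipschitzWith_reindex Sum.inl)).add (hψ.comp (lipschitzWith_reindex Sum.inr)))
  have hsmul : ∀ (c : ℝ), ∀ X ∈ LipFunctionals d, (fun ω => c * X ω) ∈ LipFunctionals d := by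
    intro c X hX
    obtain ⟨n, t, φ, hφ, rfl⟩ := exists_rep_of_mem_lipFunctionals hX
    exact mem_lipFunctionals t (hφ.const_mul c)
  have hmem := fun {F : PathSpace d → ℝ} (hF : F ∈ LipFunctionals d) (n : ℕ) =>
    hZ.comp_stepPath_mem (α := α) hE hF n
  have hlim := fun {F : PathSpace d → ℝ} (hF : F ∈ LipFunctionals d) =>
    hZ.tendsto_limitExpectation (α := α) (U := U) hE hF
  refine ⟨hconst 0, hadd, hsmul, ?_, ?_, ?_, ?_, ?_⟩
  · intro n X hX φ hφ
    choose m t ψ hψ hXeq using fun i => exists_rep_of_mem_lipFunctionals (hX i)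
    choose K hK using fun i => (hψ i).2
    -- Each inner functional has its own times; the sigma type lists them all, and one Lipschitz
    -- constant serves every component.
    have hL : LipschitzWith (∑ i, K i) (fun (y : (Σ i, Fin (m i)) → Vec d) i =>
        ψ i (fun j => y ⟨i, j⟩)) := by
      refine LipschitzWith.of_dist_le_mul fun x y => ?_
      rw [dist_pi_le_iff (by positivity)]
      intro i
      have h1 := ((hK i).comp (lipschitzWith_reindex (W := Vec d)
        (fun j : Fin (m i) => (⟨i, j⟩ : Σ i, Fin (m i))))).dist_le_mul x y
      refine h1.trans (mul_le_mul_of_nonneg_right ?_ dist_nonneg)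
      rw [mul_one]
      exact_mod_cast Finset.single_le_sum (fun _ _ => zero_le) (Finset.mem_univ i)
    have := mem_lipFunctionals_of_comp (fun p : Σ i, Fin (m i) => t p.1 p.2) hφ hL
    convert this using 4 with ω i
    rw [hXeq i]
  · exact fun X hX Y hY h => le_of_tendsto_of_tendsto' (hlim hY) (hlim hX) fun n =>
      hE.mono _ (hmem hX n) _ (hmem hY n) fun ω => h _
  · intro c
    refine tendsto_nhds_unique (hlim (hconst c)) ?_
    simp only [hE.const]
    exact tendsto_const_nhds
  · exact fun X hX Y hY => le_of_tendsto_of_tendsto' (hlim (hadd X hX Y hY))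
      ((hlim hX).add (hlim hY)) fun n => hE.subadd _ (hmem hX n) _ (hmem hY n)
  · intro c hc X hX
    refine tendsto_nhds_unique (hlim (hsmul c X hX)) (((hlim hX).const_mul c).congr fun n => ?_)
    exact (hE.pos_homog c hc _ (hmem hX n)).symm

end LimitExpectation

/-! ### The limit process is a nonlinear Lévy process -/

section Levy

variable {Ω : Type*} {d : ℕ} {H : Set (Ω → ℝ)} {E : (Ω → ℝ) → ℝ} {Z : ℕ → Ω → Vec d}
  {α δ M : ℝ} {U : Ultrafilter ℕ}

theorem scaledSum_add_sub (α : ℝ) (Z : ℕ → Ω → Vec d) (n a m : ℕ) (ω : Ω) :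
    scaledSum α Z n (a + m) ω - scaledSum α Z n a ω =
      ((n : ℝ) ^ (-(1 / α))) • ∑ i ∈ Finset.range m, Z (a + i) ω := by
  rw [scaledSum, scaledSum, Finset.sum_range_add, smul_add, add_sub_cancel_left]

/-- The increments of the partial sums are stationary. -/
theorem IsIID.map_scaledSum_sub (hE : IsSublinearExpectationSpace H E) (hZ : IsIID H E Z)
    (α : ℝ) (n a m : ℕ) {f : Vec d → ℝ} (hf : IsBddLip f) :
    E (fun ω => f (scaledSum α Z n (a + m) ω - scaledSum α Z n a ω)) =
      E (fun ω => f (scaledSum α Z n m ω)) := by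
  simp only [scaledSum_add_sub]
  have := hZ.indep_block hE a m
    (ψ := fun p => f (((n : ℝ) ^ (-(1 / α))) • p.2))
    (hf.comp ((lipschitzWith_smul_vec _).comp LipschitzWith.prod_snd))
  exact this.trans (hE.const (E (fun ω => f (scaledSum α Z n m ω))))

/-- The increments of the partial sums are independent from the past. -/
theorem IsIID.indep_scaledSum_sub (hE : IsSublinearExpectationSpace H E) (hZ : IsIID H E Z)
    (α : ℝ) (n a m : ℕ) {ι : Type*} [Fintype ι] {k : ι → ℕ} (hk : ∀ i, k i ≤ a)
    {φ : (ι → Vec d) × Vec d → ℝ} (hφ : IsBddLip φ) :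
    E (fun ω => φ (fun i => scaledSum α Z n (k i) ω,
        scaledSum α Z n (a + m) ω - scaledSum α Z n a ω)) =
      E (fun ω => E (fun ω' => φ (fun i => scaledSum α Z n (k i) ω,
        scaledSum α Z n (a + m) ω' - scaledSum α Z n a ω'))) := by
  have h1 : ∀ y, E (fun ω' => φ (y, scaledSum α Z n (a + m) ω' - scaledSum α Z n a ω')) =
      E (fun ω' => φ (y, scaledSum α Z n m ω')) := fun y =>
    hZ.map_scaledSum_sub hE α n a m (hφ.comp_prodMk y)
  simp only [h1]
  set c : ℝ := (n : ℝ) ^ (-(1 / α)) with hc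
  have hψ : IsBddLip (fun p : (Fin a → Vec d) × Vec d =>
      φ (ContinuousLinearMap.pi (fun i => initialSum d a (k i) c) p.1, c • p.2)) :=
    hφ.comp (((ContinuousLinearMap.pi (fun i => initialSum d a (k i) c)).lipschitz.comp
      LipschitzWith.prod_fst).prodMk ((lipschitzWith_smul_vec c).comp LipschitzWith.prod_snd))
  have hs : ∀ ω, ContinuousLinearMap.pi (fun i => initialSum d a (k i) c)
      (fun j : Fin a => Z j ω) = fun i => scaledSum α Z n (k i) ω := fun ω =>
    funext fun i => initialSum_apply (hk i) c fun i => Z i ω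
  have := hZ.indep_block hE a m hψ
  simp only [hs] at this
  simp only [scaledSum_add_sub]
  exact this

/-- Rounding costs at most one summand, which is negligible in the limit. -/
theorem exists_floor_add {n : ℕ} {s t r : ℝ} (hs : 0 ≤ s) (hr : 0 ≤ r) (h : s + r = t) :
    ∃ j ≤ 1, ⌊(n : ℝ) * t⌋₊ = ⌊(n : ℝ) * s⌋₊ + (⌊(n : ℝ) * r⌋₊ + j) := by
  have hn : (0 : ℝ) ≤ n := n.cast_nonneg
  have hs' := Nat.floor_le (mul_nonneg hn hs)
  have hr' := Nat.floor_le (mul_nonneg hn hr)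
  have hs2 := Nat.lt_floor_add_one ((n : ℝ) * s)
  have hr2 := Nat.lt_floor_add_one ((n : ℝ) * r)
  have ht : (n : ℝ) * t = n * s + n * r := by rw [← h]; ring
  have h1 : ⌊(n : ℝ) * s⌋₊ + ⌊(n : ℝ) * r⌋₊ ≤ ⌊(n : ℝ) * t⌋₊ := by
    apply Nat.le_floor; push_cast; linarith
  have h2 : ⌊(n : ℝ) * t⌋₊ < ⌊(n : ℝ) * s⌋₊ + ⌊(n : ℝ) * r⌋₊ + 2 := by
    rw [Nat.floor_lt (by rw [ht]; positivity)]; push_cast; linarith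
  exact ⟨⌊(n : ℝ) * t⌋₊ - (⌊(n : ℝ) * s⌋₊ + ⌊(n : ℝ) * r⌋₊), by omega, by omega⟩

theorem tendsto_one_div_rpow (hU : (U : Filter ℕ) ≤ atTop) {p : ℝ} (hp : 0 < p) (c : ℝ) :
    Tendsto (fun n : ℕ => c * ((1 : ℝ) / n) ^ p) U (𝓝 0) := by
  have h1 : Tendsto (fun n : ℕ => (1 : ℝ) / n) U (𝓝 0) :=
    tendsto_one_div_atTop_nhds_zero_nat.mono_left hU
  have h2 := (h1.rpow_const (p := p) (Or.inr hp.le)).const_mul c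
  rwa [Real.zero_rpow hp.ne', mul_zero] at h2

theorem isRandomVariable_of_canonical {ι : Type*} [Fintype ι] (t : ι → I) {W : Type*}
    [PseudoMetricSpace W] {f : (ι → Vec d) → W} {K : NNReal} (hf : LipschitzWith K f) :
    IsRandomVariable (LipFunctionals d) (fun ω => f (fun i => canonical (t i) ω)) :=
  fun _ hφ => mem_lipFunctionals_of_comp t hφ hf

theorem isRandomVariable_canonical_sub (s t : I) :
    IsRandomVariable (LipFunctionals d) (fun ω => canonical t ω - canonical s ω) := by
  have hf : LipschitzWith (1 + 1) (fun y : Bool → Vec d => y true - y false) :=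
    (LipschitzWith.eval true).sub (LipschitzWith.eval false)
  exact isRandomVariable_of_canonical (fun b => if b then t else s) hf

theorem isRandomVariable_canonical_prod {n : ℕ} (u : Fin n → I) (s t : I) :
    IsRandomVariable (LipFunctionals d)
      (fun ω => ((fun i => canonical (u i) ω), canonical t ω - canonical s ω)) := by
  have hf : LipschitzWith (max 1 (1 + 1)) (fun y : Fin n ⊕ Bool → Vec d =>
      ((fun i => y (Sum.inl i)), y (Sum.inr true) - y (Sum.inr false))) :=
    (lipschitzWith_reindex Sum.inl).prodMk
      ((LipschitzWith.eval (Sum.inr true)).sub (LipschitzWith.eval (Sum.inr false)))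
  exact isRandomVariable_of_canonical (Sum.elim u fun b => if b then t else s) hf

/-- Union bound for tails: if the sum is below `1`, every cutoff is below its cap, so each `‖y i‖ /
R` is at most the sum, hence so is their maximum. -/
theorem cutoff_pi_le {ι W : Type*} [Fintype ι] [SeminormedAddCommGroup W] {R : ℝ} (hR : 0 < R)
    (y : ι → W) : cutoff R y ≤ ∑ i, cutoff R (y i) := by
  set s := ∑ i, cutoff R (y i)
  have hle : ∀ i, cutoff R (y i) ≤ s := fun i =>
    Finset.single_le_sum (f := fun i => cutoff R (y i)) (fun _ _ => cutoff_nonneg hR _)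
      (Finset.mem_univ i)
  rcases le_or_gt 1 s with hs | hs
  · exact (min_le_left _ _).trans hs
  · refine (min_le_right _ _).trans ((div_le_iff₀ hR).2 ?_)
    have hs0 : 0 ≤ s := Finset.sum_nonneg fun _ _ => cutoff_nonneg hR _
    refine (pi_norm_le_iff_of_nonneg (by positivity)).2 fun i => (div_le_iff₀ hR).1 ?_
    rcases min_le_iff.1 (hle i) with h | h
    · linarith
    · exact h

theorem HasMomentBound.map_cutoff_values_le (hE : IsSublinearExpectationSpace H E)
    (hZ : IsIID H E Z) (hα : 0 < α) (hδ : 0 < δ) (hδ1 : δ ≤ 1) (hM : HasMomentBound E α Z δ M)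
    {n : ℕ} (hn : 1 ≤ n) {ι : Type*} [Fintype ι] {k : ι → ℕ} (hk : ∀ i, k i ≤ n) {R : ℝ}
    (hR : 0 < R) : E (fun ω => cutoff R (fun i => scaledSum α Z n (k i) ω)) ≤
      Fintype.card ι * M * R ^ (-δ) := by
  have hM0 := hM.nonneg hE
  have hmem : ∀ i ∈ (Finset.univ : Finset ι), (fun ω => cutoff R (scaledSum α Z n (k i) ω)) ∈ H :=
    fun i _ => hZ.isRandomVariable_scaledSum hE α n (k i) _ (isBddLip_cutoff hR)
  have h1 : ∀ i ∈ (Finset.univ : Finset ι),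
      E (fun ω => cutoff R (scaledSum α Z n (k i) ω)) ≤ R ^ (-δ) * M := by
    intro i _
    refine (hM.map_cutoff_le hE hZ hα hδ hδ1 hn (k i) hR).trans ?_
    refine mul_le_of_le_one_right (by positivity) ?_
    refine Real.rpow_le_one (by positivity) ?_ (by positivity)
    exact div_le_one_of_le₀ (by exact_mod_cast hk i) n.cast_nonneg
  calc _ ≤ E (fun ω => ∑ i, cutoff R (scaledSum α Z n (k i) ω)) :=
        hE.mono _ (hE.sum_mem _ hmem) _
          (hZ.isRandomVariable_values hE α n k _ (isBddLip_cutoff hR)) fun ω => cutoff_pi_le hR _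
    _ ≤ ∑ i, E (fun ω => cutoff R (scaledSum α Z n (k i) ω)) := hE.map_sum_le _ hmem
    _ ≤ ∑ _i : ι, R ^ (-δ) * M := Finset.sum_le_sum h1
    _ = Fintype.card ι * M * R ^ (-δ) := by
      rw [Finset.sum_const, Finset.card_univ, nsmul_eq_mul]; ring

theorem exists_pos_mul_rpow_neg_le (c : ℝ) (hδ : 0 < δ) {ε : ℝ} (hε : 0 < ε) :
    ∃ R : ℝ, 0 < R ∧ c * R ^ (-δ) ≤ ε := by
  have h := (tendsto_rpow_neg_atTop hδ).const_mul c
  rw [mul_zero] at h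
  obtain ⟨R, h1, h2⟩ := ((h.eventually_le_const hε).and (eventually_gt_atTop 0)).exists
  exact ⟨R, h2, h1⟩

theorem IsIID.stationary_limitExpectation (hE : IsSublinearExpectationSpace H E)
    (hZ : IsIID H E Z) (hα : 0 < α) (hδ : 0 < δ) (hδ1 : δ ≤ 1) (hM : HasMomentBound E α Z δ M)
    (hU : (U : Filter ℕ) ≤ atTop) (s t r : I) (hst : (s : ℝ) + r = t) :
    SameLaw (limitExpectation E α Z U) (fun ω => canonical t ω - canonical s ω)
      (limitExpectation E α Z U) (canonical (d := d) r) := by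
  intro φ hφ
  obtain ⟨C, K, hC0, hK0, hC, hK⟩ := hφ.exists_bounds
  have h1 := hZ.tendsto_limitExpectation (α := α) (U := U) hE
    (isRandomVariable_canonical_sub s t φ hφ)
  have h2 := hZ.tendsto_limitExpectation_canonical (α := α) (U := U) hE r hφ
  have hM0 := hM.nonneg hE
  -- Before the limit the increment has exactly the law of the walk after `⌊nr⌋ + j` steps with `j ≤
  -- 1`.
  have h3 : Tendsto (fun n : ℕ =>
      E (fun ω => φ (canonical t (stepPath α Z n ω) - canonical s (stepPath α Z n ω))) -
        E (fun ω => φ (scaledSum α Z n ⌊(n : ℝ) * (r : ℝ)⌋₊ ω))) U (𝓝 0) := by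
    refine squeeze_zero_norm' ?_
      (tendsto_one_div_rpow hU (p := δ / α) (by positivity) ((2 * C + K + 1) * M))
    filter_upwards [hU (eventually_ge_atTop 1)] with n hn
    obtain ⟨j, hj, hfl⟩ := exists_floor_add (n := n) s.2.1 r.2.1 hst
    simp only [canonical_stepPath, hfl, Real.norm_eq_abs]
    rw [hZ.map_scaledSum_sub hE α n _ _ hφ]
    refine (hM.abs_map_shift_le hE hZ hα hδ hδ1 hn _ j hC0 hK0 hC hK).trans ?_
    gcongr
    exact_mod_cast hj
  have := tendsto_nhds_unique h3 (h1.sub h2)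
  linarith

theorem IsIID.independent_limitExpectation (hE : IsSublinearExpectationSpace H E)
    (hZ : IsIID H E Z) (hα : 0 < α) (hδ : 0 < δ) (hδ1 : δ ≤ 1) (hM : HasMomentBound E α Z δ M)
    (hU : (U : Filter ℕ) ≤ atTop) {m : ℕ} (u : Fin m → I) (s t : I) (hu : ∀ i, u i ≤ s)
    (hst : s ≤ t) {φ : (Fin m → Vec d) × Vec d → ℝ} (hφ : IsBddLip φ) :
    limitExpectation E α Z U
        (fun ω => φ (fun i => canonical (u i) ω, canonical t ω - canonical s ω)) =
      limitExpectation E α Z U (fun ω => limitExpectation E α Z U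
        (fun ω' => φ (fun i => canonical (u i) ω, canonical t ω' - canonical s ω'))) := by
  obtain ⟨C, K, hC0, hK0, hC, hK⟩ := hφ.exists_bounds
  have hE' := hZ.sublinear_limitExpectation hE α U
  have hinc := isRandomVariable_canonical_sub (d := d) s t
  have hM0 := hM.nonneg hE
  set g : (Fin m → Vec d) → ℝ := fun y =>
    limitExpectation E α Z U (fun ω => φ (y, canonical t ω - canonical s ω)) with hg_def
  set k : ℕ → I → ℕ := fun n t => ⌊(n : ℝ) * (t : ℝ)⌋₊ with hk_def
  have hkle : ∀ n i, k n (u i) ≤ k n s := fun n i => Nat.floor_le_floor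
    (mul_le_mul_of_nonneg_left (Subtype.coe_le_coe.2 (hu i)) n.cast_nonneg)
  have hkst : ∀ n, k n s ≤ k n t := fun n => Nat.floor_le_floor
    (mul_le_mul_of_nonneg_left (Subtype.coe_le_coe.2 hst) n.cast_nonneg)
  have hinc' : ∀ n, IsRandomVariable H
      (fun ω => scaledSum α Z n (k n t) ω - scaledSum α Z n (k n s) ω) := fun n f hf =>
    hZ.comp_stepPath_mem hE (hinc f hf) n
  set gn : ℕ → (Fin m → Vec d) → ℝ := fun n y =>
    E (fun ω => φ (y, scaledSum α Z n (k n t) ω - scaledSum α Z n (k n s) ω)) with hgn_def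
  have hgb := hE'.bounds_map_prod hinc hφ hC hK
  have hgnb := fun n => hE.bounds_map_prod (hinc' n) hφ hC hK
  have hg : IsBddLip g := isBddLip_of_le hgb.1 hgb.2
  have hgn : ∀ n, IsBddLip (gn n) := fun n => isBddLip_of_le (hgnb n).1 (hgnb n).2
  have hpt : ∀ y, Tendsto (fun n => gn n y) U (𝓝 (g y)) := fun y =>
    hZ.tendsto_limitExpectation hE (hinc _ (hφ.comp_prodMk y))
  have hY : ∀ n, IsRandomVariable H (fun ω i => scaledSum α Z n (k n (u i)) ω) := fun n =>
    hZ.isRandomVariable_values hE α n fun i => k n (u i)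
  have hL := hZ.tendsto_limitExpectation (α := α) (U := U) hE
    (isRandomVariable_canonical_prod u s t φ hφ)
  have hR := hZ.limitExpectation_values (α := α) (U := U) hE u hg
  -- Independence is exact for the step paths, with frozen expectation `gn n`; what remains is to
  -- replace `gn n` by its limit `g`.
  have hfreeze : ∀ n, E (fun ω => φ (fun i => canonical (u i) (stepPath α Z n ω),
      canonical t (stepPath α Z n ω) - canonical s (stepPath α Z n ω))) =
      E (fun ω => gn n (fun i => scaledSum α Z n (k n (u i)) ω)) := by
    intro n
    obtain ⟨l, hl⟩ := Nat.exists_eq_add_of_le (hkst n)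
    have := hZ.indep_scaledSum_sub hE α n (k n s) l (hkle n) hφ
    rw [← hl] at this
    exact this
  have hdiff : Tendsto (fun n => E (fun ω => gn n (fun i => scaledSum α Z n (k n (u i)) ω)) -
      E (fun ω => g (fun i => scaledSum α Z n (k n (u i)) ω))) U (𝓝 0) := by
    rw [Metric.tendsto_nhds]
    intro ε hε
    -- Outside the ball `|gn n - g| ≤ 2C`, and `m` coordinates contribute to the tail. Tail and
    -- uniform error are each at most `ε / 4`.
    obtain ⟨R, hR0, hRε⟩ := exists_pos_mul_rpow_neg_le (2 * C * (m * M)) hδ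
      (show 0 < ε / 4 by positivity)
    filter_upwards [hU (eventually_ge_atTop 1), eventually_uniform_of_equiLipschitz
      (isCompact_closedBall (0 : Fin m → Vec d) R) (fun n => (hgnb n).2) hgb.2 hpt
      (show 0 < ε / 4 by positivity)] with n hn hunif
    rw [Real.dist_eq, sub_zero]
    have hcut : IsBddLip (fun y : Fin m → Vec d => ε / 4 + 2 * C * cutoff R y) :=
      (isBddLip_const _).add ((isBddLip_cutoff hR0).const_mul _)
    have hbound : ∀ y, |gn n y - g y| ≤ ε / 4 + 2 * C * cutoff R y :=
      abs_le_add_cutoff (f := fun y => gn n y - g y) hR0 (by positivity)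
        (fun y => (abs_sub _ _).trans (by linarith [(hgnb n).1 y, hgb.1 y])) fun y hy =>
          hunif y (by simpa using hy)
    have hcmem := hY n _ (isBddLip_cutoff hR0)
    have h1 := hE.abs_map_sub_le (hY n _ (hgn n)) (hY n _ hg) (hY n _ hcut) fun ω => hbound _
    have h2 := hE.subadd _ (hE.const_mem (ε / 4)) _ (hE.smul_mem (2 * C) _ hcmem)
    rw [hE.const, hE.map_const_mul hcmem (by positivity)] at h2
    have h3 := hM.map_cutoff_values_le hE hZ hα hδ hδ1 hn
      (k := fun i => k n (u i)) (fun i => floor_mul_le n (u i)) hR0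
    rw [Fintype.card_fin] at h3
    have h4 := mul_le_mul_of_nonneg_left h3 (show 0 ≤ 2 * C by positivity)
    linarith
  simp only [hfreeze] at hL
  have := tendsto_nhds_unique hdiff (hL.sub hR)
  linarith

/-- The canonical process is a nonlinear Lévy process under the limit expectation. -/
theorem IsIID.isNonlinearLevy_limitExpectation (hE : IsSublinearExpectationSpace H E)
    (hZ : IsIID H E Z) (hα : 0 < α) (hδ : 0 < δ) (hδ1 : δ ≤ 1) (hM : HasMomentBound E α Z δ M)
    (hU : (U : Filter ℕ) ≤ atTop) :
    IsNonlinearLevy (LipFunctionals d) (limitExpectation E α Z U) (canonical (d := d)) where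
  randomVariable t := fun _ hφ =>
    mem_lipFunctionals_of_comp (fun _ : Unit => t) hφ (LipschitzWith.eval ())
  cadlag ω := ω.2.1
  zero ω := ω.2.2
  stationary s t r h := hZ.stationary_limitExpectation hE hα hδ hδ1 hM hU s t r h
  indep _ u s t _ hu hst :=
    ⟨isRandomVariable_canonical_prod u s t, fun _ hφ =>
      hZ.independent_limitExpectation hE hα hδ hδ1 hM hU u s t hu hst hφ⟩

end Levy

/-! ### Extraction of convergent subsequences -/

section Subsequences

variable {Ω : Type*} {d : ℕ} {H : Set (Ω → ℝ)} {E : (Ω → ℝ) → ℝ} {Z : ℕ → Ω → Vec d}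
  {α δ M : ℝ} {U : Ultrafilter ℕ}

/-- A sequence of bounded Lipschitz functions that is dense for bounded convergence, uniformly on
balls. -/
theorem exists_seq_dense_bddLip (d : ℕ) : ∃ ψ : ℕ → Vec d → ℝ, (∀ i, IsBddLip (ψ i)) ∧
    ∀ f : Vec d → ℝ, IsBddLip f → ∃ C : ℝ, 0 ≤ C ∧ ∀ R ε : ℝ, 0 < ε → ∃ i,
      (∀ x, |f x - ψ i x| ≤ C) ∧ ∀ x, ‖x‖ ≤ R → |f x - ψ i x| ≤ ε := by
  -- The compact-open topology on `C(Vec d, ℝ)` is second countable, so each `S N` is separable. The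
  -- cap `N` keeps the approximants uniformly bounded; their Lipschitz constants need no control.
  let S : ℕ → Set C(Vec d, ℝ) := fun N => {f | (∀ x, |f x| ≤ N) ∧ IsBddLip f}
  have hne : ∀ N, Nonempty (S N) := fun N =>
    ⟨⟨0, fun x => by simp, isBddLip_const 0⟩⟩
  let ψ : ℕ → ℕ → Vec d → ℝ := fun N i => (TopologicalSpace.denseSeq (S N) i : C(Vec d, ℝ))
  refine ⟨fun i => ψ i.unpair.1 i.unpair.2,
    fun i => (TopologicalSpace.denseSeq (S i.unpair.1) i.unpair.2).2.2, fun f hf => ?_⟩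
  obtain ⟨C, K, -, -, hC, -⟩ := hf.exists_bounds
  obtain ⟨N, hN⟩ := exists_nat_ge C
  obtain ⟨L, hL⟩ := hf.2
  let f' : S N := ⟨⟨f, hL.continuous⟩, fun x => (hC x).trans hN, hf⟩
  refine ⟨2 * N, by positivity, fun R ε hε => ?_⟩
  have hunif := (ContinuousMap.tendsto_iff_forall_isCompact_tendstoUniformlyOn
    (f := (f' : C(Vec d, ℝ)))).1 (tendsto_id (x := 𝓝 (f' : C(Vec d, ℝ)))) _
    (isCompact_closedBall (0 : Vec d) R)
  have hev := (Metric.tendstoUniformlyOn_iff.1 hunif) ε hε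
  have hev' := (continuous_subtype_val.tendsto f').eventually hev
  obtain ⟨i, hi⟩ := (TopologicalSpace.denseRange_denseSeq (S N)).mem_nhds hev'
  have hi' : ∀ x ∈ Metric.closedBall (0 : Vec d) R, dist (f x) (ψ N i x) < ε := hi
  have hψN : ∀ x, |ψ N i x| ≤ N := (TopologicalSpace.denseSeq (S N) i).2.1
  refine ⟨Nat.pair N i, fun x => ?_, fun x hx => ?_⟩
  · simp only [Nat.unpair_pair]
    exact (abs_sub _ _).trans (by linarith [(hC x).trans hN, hψN x])
  · simp only [Nat.unpair_pair]
    exact (hi' x (by simpa using hx)).le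

/-- If two functions are close on a ball, so are their expectations, up to the tails. -/
theorem IsSublinearExpectationSpace.abs_map_sub_le_of_ball (hE : IsSublinearExpectationSpace H E)
    {W : Type*} [SeminormedAddCommGroup W] {X : Ω → W} (hX : IsRandomVariable H X) {f g : W → ℝ}
    (hf : IsBddLip f) (hg : IsBddLip g) {C R ε b : ℝ} (hR : 0 < R) (hε : 0 ≤ ε) (hC0 : 0 ≤ C)
    (hC : ∀ x, |f x - g x| ≤ C) (hfg : ∀ x, ‖x‖ ≤ R → |f x - g x| ≤ ε)
    (hb : E (fun ω => cutoff R (X ω)) ≤ b) :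
    |E (fun ω => f (X ω)) - E (fun ω => g (X ω))| ≤ ε + C * b := by
  have hc := hX _ (isBddLip_cutoff hR)
  have h1 := hE.abs_map_sub_le (hX _ hf) (hX _ hg)
    (hE.add_mem _ (hE.const_mem ε) _ (hE.smul_mem C _ hc))
    fun ω => abs_le_add_cutoff (f := fun x => f x - g x) hR hε hC hfg (X ω)
  have h2 := hE.subadd _ (hE.const_mem ε) _ (hE.smul_mem C _ hc)
  rw [hE.const, hE.map_const_mul hc hC0] at h2
  have h3 := mul_le_mul_of_nonneg_left hb hC0
  linarith

theorem HasMomentBound.map_cutoff_normSum_le (hE : IsSublinearExpectationSpace H E)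
    (hZ : IsIID H E Z) (hα : 0 < α) (hδ : 0 < δ) (hδ1 : δ ≤ 1) (hM : HasMomentBound E α Z δ M)
    {n : ℕ} (hn : 1 ≤ n) {R : ℝ} (hR : 0 < R) :
    E (fun ω => cutoff R (normSum α Z n ω)) ≤ M * R ^ (-δ) := by
  have := hM.map_cutoff_le hE hZ hα hδ hδ1 hn n hR
  have hn0 : (n : ℝ) ≠ 0 := by positivity
  rw [div_self hn0, Real.one_rpow, mul_one, mul_comm] at this
  exact this

theorem IsIID.tendsto_limitExpectation_one (hE : IsSublinearExpectationSpace H E)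
    (hZ : IsIID H E Z) {φ : Vec d → ℝ} (hφ : IsBddLip φ) :
    Tendsto (fun n : ℕ => E (fun ω => φ (normSum α Z n ω))) U
      (𝓝 (limitExpectation E α Z U (fun ω => φ (canonical 1 ω)))) := by
  have := hZ.tendsto_limitExpectation_canonical (α := α) (U := U) hE 1 hφ
  simpa only [Icc.coe_one, mul_one, Nat.floor_natCast, ← normSum_eq_scaledSum] using this

/-- Convergence of countably many expectations along a subsequence gives convergence in law. -/
theorem IsIID.exists_convergesInLaw (hE : IsSublinearExpectationSpace H E)
    (hZ : IsIID H E Z) (hα : 0 < α) (hδ : 0 < δ) (hδ1 : δ ≤ 1) (hM : HasMomentBound E α Z δ M)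
    {k : ℕ → ℕ} (hk : StrictMono k) :
    ∃ j : ℕ → ℕ, StrictMono j ∧ ConvergesInLaw E (fun i => normSum α Z ((k ∘ j) i))
      (limitExpectation E α Z ((hyperfilter ℕ).map k)) (canonical (d := d) 1) := by
  set U := (hyperfilter ℕ).map k
  have hU : (U : Filter ℕ) ≤ atTop := hk.tendsto_atTop.mono_left Nat.hyperfilter_le_atTop
  obtain ⟨ψ, hψ, hdense⟩ := exists_seq_dense_bddLip d
  have hE' := hZ.sublinear_limitExpectation hE α U
  set L : (Vec d → ℝ) → ℝ := fun φ => limitExpectation E α Z U (fun ω => φ (canonical 1 ω))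
  have hlim : ∀ {φ : Vec d → ℝ}, IsBddLip φ →
      Tendsto (fun i : ℕ => E (fun ω => φ (normSum α Z (k i) ω))) (hyperfilter ℕ) (𝓝 (L φ)) := by
    intro φ hφ
    exact tendsto_map'_iff.1 (hZ.tendsto_limitExpectation_one (α := α) (U := U) hE hφ)
  -- Whatever holds eventually along an ultrafilter finer than `atTop` holds for arbitrarily large
  -- indices; testing the first `N + 1` functions to accuracy `1 / (N + 1)` makes the extraction
  -- diagonal.
  have hfreq : ∀ N : ℕ, ∃ᶠ i in atTop, ∀ m ≤ N,
      |E (fun ω => ψ m (normSum α Z (k i) ω)) - L (ψ m)| < 1 / ((N : ℝ) + 1) := by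
    intro N
    have h : ∀ᶠ i in (hyperfilter ℕ : Filter ℕ), ∀ m ∈ Set.Iic N,
        |E (fun ω => ψ m (normSum α Z (k i) ω)) - L (ψ m)| < 1 / ((N : ℝ) + 1) := by
      rw [eventually_all_finite (Set.finite_Iic N)]
      intro m _
      have := Metric.tendsto_nhds.1 (hlim (hψ m)) (1 / ((N : ℝ) + 1)) (by positivity)
      simpa only [Real.dist_eq] using this
    exact h.frequently.filter_mono Nat.hyperfilter_le_atTop
  obtain ⟨j, hj, hjP⟩ := extraction_forall_of_frequently hfreq
  refine ⟨j, hj, fun f hf => ?_⟩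
  have hX1 : IsRandomVariable (LipFunctionals d) (canonical (d := d) 1) :=
    (hZ.isNonlinearLevy_limitExpectation hE hα hδ hδ1 hM hU).randomVariable 1
  obtain ⟨C, hC0, hdf⟩ := hdense f hf
  rw [Metric.tendsto_nhds]
  intro ε hε
  -- Replacing `f` by `ψ m` costs `ε / 8` on the ball and `ε / 8` in the tail, both before and in
  -- the limit; with `ε / 4` from the extraction this stays below `ε`.
  obtain ⟨R, hR0, hRε⟩ := exists_pos_mul_rpow_neg_le (C * M) hδ (show 0 < ε / 8 by positivity)
  obtain ⟨m, hmC, hmR⟩ := hdf R (ε / 8) (by positivity)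
  have hcutL : L (cutoff R) ≤ M * R ^ (-δ) := by
    refine le_of_tendsto (hlim (isBddLip_cutoff hR0)) ?_
    filter_upwards [Nat.hyperfilter_le_atTop (eventually_ge_atTop 1)] with i hi
    exact hM.map_cutoff_normSum_le hE hZ hα hδ hδ1 (hi.trans hk.le_apply) hR0
  have hlarge : ∀ᶠ N : ℕ in atTop, 1 / ((N : ℝ) + 1) < ε / 4 :=
    tendsto_one_div_add_atTop_nhds_zero_nat.eventually_lt_const (by positivity)
  filter_upwards [hlarge, eventually_ge_atTop m, eventually_ge_atTop 1] with N hN hmN h1N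
  have h1 : 1 ≤ k (j N) := h1N.trans (hj.le_apply.trans hk.le_apply)
  have e1 := hE.abs_map_sub_le_of_ball (hZ.isRandomVariable_scaledSum hE α (k (j N)) (k (j N)))
    hf (hψ m) hR0 (by positivity) hC0 hmC hmR
    (hM.map_cutoff_normSum_le hE hZ hα hδ hδ1 h1 hR0)
  have e2 := hE'.abs_map_sub_le_of_ball hX1 hf (hψ m) hR0 (by positivity) hC0 hmC hmR hcutL
  have e3 := (hjP N m hmN).trans hN
  have e1' := abs_le.1 e1
  have e2' := abs_le.1 e2
  have e3' := abs_lt.1 e3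
  simp only [← normSum_eq_scaledSum] at e1'
  rw [Real.dist_eq, abs_lt]
  simp only [L, Function.comp_apply] at *
  constructor <;> linarith

theorem IsIID.exists_levyLimit_subseq (hE : IsSublinearExpectationSpace H E)
    (hZ : IsIID H E Z) (hα : 0 < α) (hδ : 0 < δ) (hδ1 : δ ≤ 1) (hM : HasMomentBound E α Z δ M)
    {k : ℕ → ℕ} (hk : StrictMono k) :
    ∃ j : ℕ → ℕ, StrictMono j ∧
      ∃ E' : (PathSpace d → ℝ) → ℝ, IsLevyLimitAlong E α Z (k ∘ j) E' := by
  obtain ⟨j, hj, hconv⟩ := hZ.exists_convergesInLaw hE hα hδ hδ1 hM hk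
  refine ⟨j, hj, _, hZ.sublinear_limitExpectation hE α _,
    hZ.isNonlinearLevy_limitExpectation hE hα hδ hδ1 hM ?_, hconv⟩
  rw [Ultrafilter.coe_map]
  exact hk.tendsto_atTop.mono_left Nat.hyperfilter_le_atTop

/-- If convergence failed for some `φ`, a subsequence would stay `ε` away from the candidate value;
it has a further subsequence with a Lévy limit, whose law at time 1 is the same by uniqueness. -/
theorem exists_levyLimit_of_unique
    (hsub : ∀ k : ℕ → ℕ, StrictMono k → ∃ j : ℕ → ℕ, StrictMono j ∧
      ∃ E' : (PathSpace d → ℝ) → ℝ, IsLevyLimitAlong E α Z (k ∘ j) E')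
    (huniq : ∀ (k₁ k₂ : ℕ → ℕ) (E₁ E₂ : (PathSpace d → ℝ) → ℝ), StrictMono k₁ → StrictMono k₂ →
        IsLevyLimitAlong E α Z k₁ E₁ → IsLevyLimitAlong E α Z k₂ E₂ →
        SameLaw E₁ (canonical (d := d) 1) E₂ (canonical (d := d) 1)) :
    ∃ E' : (PathSpace d → ℝ) → ℝ, IsLevyLimitAlong E α Z id E' := by
  obtain ⟨j, hj, E', hE'⟩ := hsub id strictMono_id
  refine ⟨E', hE'.sublinear, hE'.levy, fun φ hφ => ?_⟩
  by_contra hnot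
  rw [Metric.tendsto_nhds] at hnot
  push Not at hnot
  obtain ⟨ε, hε, hfreq⟩ := hnot
  obtain ⟨k, hk, hkP⟩ := extraction_of_frequently_atTop hfreq
  obtain ⟨l, hl, E₂, hE₂⟩ := hsub k hk
  have hconv := hE₂.converges φ hφ
  rw [← huniq (id ∘ j) (k ∘ l) E' E₂ hj (hk.comp hl) hE' hE₂ φ hφ] at hconv
  obtain ⟨i, hi⟩ := ((Metric.tendsto_nhds.1 hconv) ε hε).exists
  exact absurd hi (not_lt.2 (hkP (l i)))

end Subsequences

/-! ### Mollification -/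

section Mollification

variable {d : ℕ}

-- All derivatives fall on the compactly supported factor. Each one changes the target spaces and
-- the bilinear map, so these are quantified inside the induction.
open scoped Convolution ContDiff in
theorem exists_bound_iteratedFDeriv_convolution {g : Vec d → ℝ} (hg : Continuous g) {C : ℝ}
    (hC : ∀ x, |g x| ≤ C) (k : ℕ) : ∀ {G F : Type} [NormedAddCommGroup G] [NormedSpace ℝ G]
    [NormedAddCommGroup F] [NormedSpace ℝ F] (L : G →L[ℝ] ℝ →L[ℝ] F) (f : Vec d → G),
    HasCompactSupport f → ContDiff ℝ ∞ f →
    ∃ B : ℝ, ∀ x, ‖iteratedFDeriv ℝ k (f ⋆[L] g) x‖ ≤ B := by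
  induction k with
  | zero =>
    intro G F _ _ _ _ L f hf hsm
    refine ⟨∫ t, ‖L‖ * ‖f t‖ * C, fun x => ?_⟩
    rw [norm_iteratedFDeriv_zero, convolution_def]
    refine norm_integral_le_of_norm_le ?_ (Eventually.of_forall fun t => ?_)
    · exact ((hsm.continuous.integrable_of_hasCompactSupport hf).norm.const_mul _).mul_const _
    · refine (L.le_opNorm₂ _ _).trans ?_
      exact mul_le_mul_of_nonneg_left (hC _) (by positivity)
  | succ k ih =>
    intro G F _ _ _ _ L f hf hsm
    obtain ⟨B, hB⟩ := ih (L.precompL (Vec d)) (fderiv ℝ f) (hf.fderiv ℝ)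
      (hsm.fderiv_right (by norm_cast))
    refine ⟨B, fun x => ?_⟩
    have hfd : fderiv ℝ (f ⋆[L] g) = (fderiv ℝ f ⋆[L.precompL (Vec d)] g) := funext fun x =>
      (hf.hasFDerivAt_convolution_left L (hsm.of_le (by norm_cast)) hg.locallyIntegrable x).fderiv
    rw [← norm_iteratedFDeriv_fderiv, hfd]
    exact hB x

/-- Probability measures near the origin that smoothen bounded Lipschitz functions. -/
theorem exists_mollifier (d : ℕ) {ε : ℝ} (hε : 0 < ε) : ∃ ν : Measure (Vec d),
    IsProbabilityMeasure ν ∧ (∀ᵐ z ∂ν, ‖z‖ ≤ ε) ∧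
      ∀ f : Vec d → ℝ, IsBddLip f → IsCb3 (fun x => ∫ z, f (x - z) ∂ν) := by
  let b : ContDiffBump (0 : Vec d) := ⟨ε / 2, ε, by positivity, by linarith⟩
  set ρ : Vec d → ℝ := b.normed volume with hρ
  have hρ0 : ∀ z, 0 ≤ ρ z := fun z => b.nonneg_normed z
  have hρc : Continuous ρ := b.continuous_normed
  have hρm : Measurable (fun z => ENNReal.ofReal (ρ z)) := hρc.measurable.ennreal_ofReal
  refine ⟨volume.withDensity (fun z => ENNReal.ofReal (ρ z)), ⟨?_⟩, ?_, fun f hf => ?_⟩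
  · rw [withDensity_apply _ MeasurableSet.univ, Measure.restrict_univ,
      ← ofReal_integral_eq_lintegral_ofReal b.integrable_normed (Eventually.of_forall hρ0),
      b.integral_normed, ENNReal.ofReal_one]
  · rw [ae_withDensity_iff hρm]
    refine Eventually.of_forall fun z hz => ?_
    have hz' : z ∈ Function.support ρ := fun h0 => hz (by rw [h0, ENNReal.ofReal_zero])
    rw [hρ, b.support_normed_eq] at hz'
    simpa using (Metric.mem_ball.1 hz').le
  · obtain ⟨C, K, -, -, hC, hK⟩ := hf.exists_bounds
    obtain ⟨L, hL⟩ := hf.2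
    have heq : (fun x => ∫ z, f (x - z) ∂(volume.withDensity (fun z => ENNReal.ofReal (ρ z)))) =
        MeasureTheory.convolution ρ f (ContinuousLinearMap.lsmul ℝ ℝ) volume := by
      funext x
      rw [integral_withDensity_eq_integral_toReal_smul hρm
        (Eventually.of_forall fun _ => ENNReal.ofReal_lt_top), convolution_def]
      refine integral_congr_ae (Eventually.of_forall fun z => ?_)
      simp [ENNReal.toReal_ofReal (hρ0 z)]
    rw [heq]
    have hsm : ∀ {n : ℕ∞}, ContDiff ℝ n ρ := b.contDiff_normed
    refine ⟨b.hasCompactSupport_normed.contDiff_convolution_left _ hsm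
      hL.continuous.locallyIntegrable, fun k _ => ?_⟩
    exact exists_bound_iteratedFDeriv_convolution hL.continuous hC k _ ρ
      b.hasCompactSupport_normed hsm

theorem IsBddLip.integrable_sub {f : Vec d → ℝ} (hf : IsBddLip f) (ν : Measure (Vec d))
    [IsFiniteMeasure ν] (x : Vec d) : Integrable (fun z => f (x - z)) ν := by
  obtain ⟨⟨C, hC⟩, L, hL⟩ := hf
  exact Integrable.of_bound ((hL.continuous.comp (by fun_prop)).aestronglyMeasurable) C
    (Eventually.of_forall fun z => hC _)

theorem IsBddLip.integral_sub_bounds {f : Vec d → ℝ} (hf : IsBddLip f) {C K : ℝ}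
    (hC : ∀ x, |f x| ≤ C) (hK : ∀ x y, |f x - f y| ≤ K * dist x y) (ν : Measure (Vec d))
    [IsProbabilityMeasure ν] : (∀ x, |∫ z, f (x - z) ∂ν| ≤ C) ∧
      ∀ x y, |(∫ z, f (x - z) ∂ν) - ∫ z, f (y - z) ∂ν| ≤ K * dist x y := by
  constructor
  · intro x
    simpa using norm_integral_le_of_norm_le_const (μ := ν) (f := fun z => f (x - z))
      (Eventually.of_forall fun z => hC _)
  · intro x y
    rw [← integral_sub (hf.integrable_sub ν x) (hf.integrable_sub ν y)]
    simpa using norm_integral_le_of_norm_le_const (μ := ν) (f := fun z => f (x - z) - f (y - z))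
      (C := K * dist x y) (Eventually.of_forall fun z => by simpa using hK (x - z) (y - z))

theorem IsBddLip.integral_sub {f : Vec d → ℝ} (hf : IsBddLip f) (ν : Measure (Vec d))
    [IsProbabilityMeasure ν] : IsBddLip (fun x => ∫ z, f (x - z) ∂ν) := by
  obtain ⟨C, K, -, -, hC, hK⟩ := hf.exists_bounds
  obtain ⟨h1, h2⟩ := hf.integral_sub_bounds hC hK ν
  exact isBddLip_of_le h1 h2

theorem abs_integral_sub_sub_le {f : Vec d → ℝ} (hf : IsBddLip f) {K ε : ℝ} (hK0 : 0 ≤ K)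
    (hK : ∀ x y, |f x - f y| ≤ K * dist x y) {ν : Measure (Vec d)}
    [IsProbabilityMeasure ν] (hν : ∀ᵐ z ∂ν, ‖z‖ ≤ ε) (x : Vec d) :
    |(∫ z, f (x - z) ∂ν) - f x| ≤ K * ε := by
  have h : (∫ z, f (x - z) ∂ν) - f x = ∫ z, (f (x - z) - f x) ∂ν := by
    rw [MeasureTheory.integral_sub (hf.integrable_sub ν x) (integrable_const _)]; simp
  rw [h]
  have := norm_integral_le_of_norm_le_const (μ := ν) (f := fun z => f (x - z) - f x)
    (C := K * ε) (by
      filter_upwards [hν] with z hz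
      refine (hK _ _).trans (mul_le_mul_of_nonneg_left ?_ hK0)
      simpa [dist_eq_norm] using hz)
  simpa using this

theorem SimpleFunc.integral_comp_eq_sum {β : Type*} [MeasurableSpace β] (ν : Measure β)
    [IsFiniteMeasure ν] {V : Type*} (s : SimpleFunc β V) (g : V → ℝ) :
    ∫ z, g (s z) ∂ν = ∑ v ∈ s.range, ν.real (s ⁻¹' {v}) * g v := by
  have h : ∀ z, g (s z) = ∑ v ∈ s.range, (s ⁻¹' {v}).indicator (fun _ => g v) z := by
    intro z
    rw [Finset.sum_eq_single (s z)]
    · simp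
    · intro v _ hv
      exact Set.indicator_of_notMem (fun h => hv (Set.mem_singleton_iff.1 h).symm)
        (fun _ => g v)
    · intro h; exact absurd (s.mem_range_self z) h
  simp only [h]
  rw [integral_finsetSum _ fun v _ =>
    (integrable_const (g v)).indicator (s.measurableSet_fiber v)]
  refine Finset.sum_congr rfl fun v _ => ?_
  rw [integral_indicator_const _ (s.measurableSet_fiber v), smul_eq_mul]

/-- Jensen's inequality for a sublinear expectation and a convolution. -/
theorem IsSublinearExpectationSpace.map_integral_sub_le {Ω : Type*} {H : Set (Ω → ℝ)}
    {E : (Ω → ℝ) → ℝ} (hE : IsSublinearExpectationSpace H E) {X : Ω → Vec d}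
    (hX : IsRandomVariable H X) {f : Vec d → ℝ} (hf : IsBddLip f) (ν : Measure (Vec d))
    [IsProbabilityMeasure ν] {ε : ℝ} (hν : ∀ᵐ z ∂ν, ‖z‖ ≤ ε) :
    E (fun ω => ∫ z, f (X ω - z) ∂ν) ≤ ∫ z, E (fun ω => f (X ω - z)) ∂ν := by
  obtain ⟨C, K, hC0, hK0, hC, hK⟩ := hf.exists_bounds
  obtain ⟨L, hL⟩ := hf.2
  have hfv : ∀ v, IsBddLip (fun x => f (x - v)) := fun v => by
    simpa [sub_eq_add_neg, add_comm] using hf.comp_left (-v)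
  set h : Vec d → ℝ := fun z => E (fun ω => f (X ω - z)) with hh
  have hhK : ∀ v w, |h v - h w| ≤ K * ‖v - w‖ := fun v w =>
    hE.abs_map_sub_le_const (hX _ (hfv v)) (hX _ (hfv w)) fun ω => by
      refine (hK _ _).trans (le_of_eq ?_)
      rw [dist_sub_left, dist_eq_norm]
  have hhb : IsBddLip h := isBddLip_of_le (fun v => hE.abs_map_le (hX _ (hfv v)) fun ω => hC _)
    fun v w => by simpa [dist_eq_norm] using hhK v w
  have hhint : ∀ {g : Vec d → Vec d}, Measurable g → Integrable (fun z => h (g z)) ν := by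
    intro g hg
    obtain ⟨⟨C', hC'⟩, L', hL'⟩ := hhb
    exact Integrable.of_bound (hL'.continuous.measurable.comp hg).aestronglyMeasurable C'
      (Eventually.of_forall fun z => hC' _)
  have hfint : ∀ x {g : Vec d → Vec d}, Measurable g → Integrable (fun z => f (x - g z)) ν := by
    intro x g hg
    exact Integrable.of_bound (hL.continuous.measurable.comp
      (measurable_const.sub hg)).aestronglyMeasurable C (Eventually.of_forall fun z => hC _)
  -- Only finite subadditivity is available. For `s n z` in place of `z` the integral is a finite
  -- convex combination; the error is controlled by the Lipschitz constant, once on each side of the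
  -- inequality.
  set s : ℕ → SimpleFunc (Vec d) (Vec d) := fun n =>
    SimpleFunc.approxOn id measurable_id univ 0 (mem_univ _) n
  have hsn : ∀ n z, ‖s n z - z‖ ≤ 3 * ‖z‖ := fun n z => by
    have := SimpleFunc.norm_approxOn_zero_le (f := (id : Vec d → Vec d)) measurable_id
      (mem_univ (0 : Vec d)) z n
    have h2 := norm_sub_le (s n z) z
    simp only [id] at this
    linarith
  have hidint : Integrable (fun z : Vec d => 3 * ‖z‖) ν :=
    (Integrable.of_bound (C := ε) (by fun_prop) (by simpa using hν)).const_mul 3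
  have hsint : ∀ n, Integrable (fun z => ‖s n z - z‖) ν := fun n =>
    hidint.mono' (by
      exact ((s n).measurable.sub measurable_id).norm.aestronglyMeasurable)
      (Eventually.of_forall fun z => by simpa using hsn n z)
  have hlim : Tendsto (fun n => ∫ z, ‖s n z - z‖ ∂ν) atTop (𝓝 0) := by
    have := tendsto_integral_of_dominated_convergence (μ := ν)
      (F := fun n z => ‖s n z - z‖) (f := fun _ => (0 : ℝ)) (fun z => 3 * ‖z‖)
      (fun n => (hsint n).aestronglyMeasurable) hidint
      (fun n => Eventually.of_forall fun z => by simpa using hsn n z)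
      (Eventually.of_forall fun z => by
        have ht : Tendsto (fun n => s n z) atTop (𝓝 z) :=
          SimpleFunc.tendsto_approxOn measurable_id (mem_univ _) (by simp)
        simpa using (ht.sub_const z).norm)
    simpa using this
  have hstep : ∀ n, E (fun ω => ∫ z, f (X ω - z) ∂ν) ≤
      (∫ z, h z ∂ν) + 2 * K * ∫ z, ‖s n z - z‖ ∂ν := by
    intro n
    set e := ∫ z, ‖s n z - z‖ ∂ν
    have hsm := (s n).measurable
    have h1 : ∀ x, |(∫ z, f (x - z) ∂ν) - ∫ z, f (x - s n z) ∂ν| ≤ K * e := by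
      intro x
      rw [← MeasureTheory.integral_sub (hfint x measurable_id') (hfint x hsm)]
      rw [← integral_const_mul]
      refine norm_integral_le_of_norm_le (f := fun z => f (x - z) - f (x - s n z))
        ((hsint n).const_mul K)
        (Eventually.of_forall fun z => (hK _ _).trans (le_of_eq ?_))
      rw [dist_sub_left, dist_comm, dist_eq_norm]
    have h2 : |(∫ z, h (s n z) ∂ν) - ∫ z, h z ∂ν| ≤ K * e := by
      rw [← MeasureTheory.integral_sub (hhint hsm) (hhint measurable_id'), ← integral_const_mul]
      exact norm_integral_le_of_norm_le (f := fun z => h (s n z) - h z) ((hsint n).const_mul K)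
        (Eventually.of_forall fun z => hhK _ _)
    have hterm : ∀ v ∈ (s n).range, (fun ω => ν.real (s n ⁻¹' {v}) * f (X ω - v)) ∈ H :=
      fun v _ => hE.smul_mem _ _ (hX _ (hfv v))
    have hfs : (fun ω => ∫ z, f (X ω - s n z) ∂ν) =
        fun ω => ∑ v ∈ (s n).range, ν.real (s n ⁻¹' {v}) * f (X ω - v) := funext fun ω =>
      SimpleFunc.integral_comp_eq_sum ν (s n) (fun v => f (X ω - v))
    have h3 : E (fun ω => ∫ z, f (X ω - s n z) ∂ν) ≤ ∫ z, h (s n z) ∂ν := by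
      rw [hfs, SimpleFunc.integral_comp_eq_sum ν (s n) h]
      refine (hE.map_sum_le _ hterm).trans (le_of_eq (Finset.sum_congr rfl fun v _ => ?_))
      exact hE.map_const_mul (hX _ (hfv v)) measureReal_nonneg
    have h4 := hE.abs_map_sub_le_const (hX _ (hf.integral_sub ν))
      (by rw [hfs]; exact hE.sum_mem _ hterm) fun ω => h1 (X ω)
    linarith [(abs_le.1 h4).2, (abs_le.1 h2).2]
  have := ge_of_tendsto' ((hlim.const_mul (2 * K)).const_add (∫ z, h z ∂ν)) hstep
  simpa using this

end Mollification

/-! ### Comparison of nonlinear Lévy processes -/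

section Comparison

/-- The operator `f ↦ E[f(x + X_t)]`. -/
noncomputable def transition {Ω : Type*} {d : ℕ} (E : (Ω → ℝ) → ℝ) (X : I → Ω → Vec d) (t : I)
    (f : Vec d → ℝ) (x : Vec d) : ℝ :=
  E (fun ω => f (x + X t ω))

variable {Ω : Type*} {d : ℕ} {H : Set (Ω → ℝ)} {E : (Ω → ℝ) → ℝ} {X : I → Ω → Vec d}

theorem IsNonlinearLevy.shift_mem (hX : IsNonlinearLevy H E X) (t : I) {f : Vec d → ℝ}
    (hf : IsBddLip f) (x : Vec d) : (fun ω => f (x + X t ω)) ∈ H :=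
  hX.randomVariable t _ (hf.comp_left x)

theorem IsNonlinearLevy.transition_bounds (hE : IsSublinearExpectationSpace H E)
    (hX : IsNonlinearLevy H E X) (t : I) {f : Vec d → ℝ} (hf : IsBddLip f) {C K : ℝ}
    (hC : ∀ x, |f x| ≤ C) (hK : ∀ x y, |f x - f y| ≤ K * dist x y) :
    (∀ x, |transition E X t f x| ≤ C) ∧
      ∀ x y, |transition E X t f x - transition E X t f y| ≤ K * dist x y :=
  ⟨fun x => hE.abs_map_le (hX.shift_mem t hf x) fun ω => hC _, fun x y =>
    hE.abs_map_sub_le_const (hX.shift_mem t hf x) (hX.shift_mem t hf y) fun ω => by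
      simpa using hK (x + X t ω) (y + X t ω)⟩

theorem IsNonlinearLevy.isBddLip_transition (hE : IsSublinearExpectationSpace H E)
    (hX : IsNonlinearLevy H E X) (t : I) {f : Vec d → ℝ} (hf : IsBddLip f) :
    IsBddLip (transition E X t f) := by
  obtain ⟨C, K, -, -, hC, hK⟩ := hf.exists_bounds
  obtain ⟨h1, h2⟩ := hX.transition_bounds hE t hf hC hK
  exact isBddLip_of_le h1 h2

theorem IsNonlinearLevy.transition_le_add (hE : IsSublinearExpectationSpace H E)
    (hX : IsNonlinearLevy H E X) (t : I) {f g : Vec d → ℝ} (hf : IsBddLip f) (hg : IsBddLip g)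
    {c : ℝ} (h : ∀ x, f x ≤ g x + c) (x : Vec d) :
    transition E X t f x ≤ transition E X t g x + c := by
  have := hE.map_le_map_add (hX.shift_mem t hf x) (hX.shift_mem t hg x) (hE.const_mem c)
    fun _ => h _
  rwa [hE.const] at this

theorem IsNonlinearLevy.abs_transition_sub_le (hE : IsSublinearExpectationSpace H E)
    (hX : IsNonlinearLevy H E X) (t : I) {f g : Vec d → ℝ} (hf : IsBddLip f) (hg : IsBddLip g)
    {c : ℝ} (h : ∀ x, |f x - g x| ≤ c) (x : Vec d) :
    |transition E X t f x - transition E X t g x| ≤ c :=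
  hE.abs_map_sub_le_const (hX.shift_mem t hf x) (hX.shift_mem t hg x) fun _ => h _

theorem IsNonlinearLevy.transition_zero (hE : IsSublinearExpectationSpace H E)
    (hX : IsNonlinearLevy H E X) (f : Vec d → ℝ) : transition E X 0 f = f := by
  funext x
  simp only [transition, hX.zero, add_zero, hE.const]

/-- The semigroup property. -/
theorem IsNonlinearLevy.transition_add (hX : IsNonlinearLevy H E X) {s r t : I}
    (h : (s : ℝ) + r = t) {f : Vec d → ℝ} (hf : IsBddLip f) :
    transition E X t f = transition E X s (transition E X r f) := by
  funext x
  have hst : s ≤ t := Subtype.coe_le_coe.1 (by linarith [r.2.1])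
  have hφ : IsBddLip (fun p : (Fin 1 → Vec d) × Vec d => f (x + p.1 0 + p.2)) :=
    hf.comp (((LipschitzWith.const x).add
      ((LipschitzWith.eval (0 : Fin 1)).comp LipschitzWith.prod_fst)).add LipschitzWith.prod_snd)
  have h1 := (hX.indep 1 (fun _ => s) s t monotone_const (fun _ => le_rfl) hst).eq _ hφ
  have h2 : ∀ y, E (fun ω => f (y + (X t ω - X s ω))) = E (fun ω => f (y + X r ω)) := fun y =>
    hX.stationary s t r h _ (hf.comp_left y)
  simp only [add_assoc, add_sub_cancel] at h1
  simp only [transition, h1, ← add_assoc, h2]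

/-- Convexity and translation invariance of the semigroup; this makes the mollified semigroup a
supersolution. -/
theorem IsNonlinearLevy.transition_integral_sub_le (hE : IsSublinearExpectationSpace H E)
    (hX : IsNonlinearLevy H E X) (t : I) {f : Vec d → ℝ} (hf : IsBddLip f) (ν : Measure (Vec d))
    [IsProbabilityMeasure ν] {ε : ℝ} (hν : ∀ᵐ z ∂ν, ‖z‖ ≤ ε) (x : Vec d) :
    transition E X t (fun y => ∫ z, f (y - z) ∂ν) x ≤ ∫ z, transition E X t f (x - z) ∂ν := by
  have hY : IsRandomVariable H (fun ω => x + X t ω) := fun _ hφ => hX.shift_mem t hφ x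
  have := hE.map_integral_sub_le hY hf ν hν
  simpa only [transition, sub_add_eq_add_sub] using this

/-- `f ↦ E[f(x + X_t)]` is continuous at `t = 0`, uniformly in `x`. -/
def IsContinuousAtZero (E : (Ω → ℝ) → ℝ) (X : I → Ω → Vec d) : Prop :=
  ∀ f : Vec d → ℝ, IsBddLip f → ∀ ε > 0, ∃ η > 0, ∀ r : I, (r : ℝ) < η →
    ∀ x, |transition E X r f x - f x| ≤ ε

/-- By the semigroup property `T_t f - T_s f = T_s(T_{t-s} f) - T_s f`, and `T_s` is a contraction
in the sup norm. -/
theorem IsNonlinearLevy.abs_transition_sub_transition_le (hE : IsSublinearExpectationSpace H E)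
    (hX : IsNonlinearLevy H E X) {f : Vec d → ℝ} (hf : IsBddLip f) {ε η : ℝ}
    (h : ∀ r : I, (r : ℝ) < η → ∀ x, |transition E X r f x - f x| ≤ ε) {s t : I}
    (hst : |(t : ℝ) - s| < η) (x : Vec d) :
    |transition E X t f x - transition E X s f x| ≤ ε := by
  have key : ∀ {s t : I}, s ≤ t → |(t : ℝ) - s| < η →
      |transition E X t f x - transition E X s f x| ≤ ε := by
    intro s t hle hst
    have hle' : (s : ℝ) ≤ t := hle
    let r : I := ⟨(t : ℝ) - s, by linarith, by linarith [t.2.2, s.2.1]⟩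
    have hr : (r : ℝ) = t - s := rfl
    rw [hX.transition_add (s := s) (r := r) (t := t) (by rw [hr]; ring) hf]
    exact hX.abs_transition_sub_le hE s (hX.isBddLip_transition hE r hf) hf
      (h r (by rw [hr]; exact (le_abs_self _).trans_lt hst)) x
  rcases le_total s t with hle | hle
  · exact key hle hst
  · rw [abs_sub_comm]
    exact key hle (by rwa [abs_sub_comm])

theorem abs_integral_sub_le_of_abs_sub_le {f g : Vec d → ℝ} (hf : IsBddLip f) (hg : IsBddLip g)
    (ν : Measure (Vec d)) [IsProbabilityMeasure ν] {c : ℝ} (h : ∀ x, |f x - g x| ≤ c)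
    (x : Vec d) : |(∫ z, f (x - z) ∂ν) - ∫ z, g (x - z) ∂ν| ≤ c := by
  rw [← integral_sub (hf.integrable_sub ν x) (hg.integrable_sub ν x)]
  simpa using norm_integral_le_of_norm_le_const (μ := ν) (f := fun z => f (x - z) - g (x - z))
    (C := c) (Eventually.of_forall fun z => h _)

/-- A continuous family whose supremum has nonpositive right derivatives stays nonpositive. -/
theorem nonpos_of_iSup_growth {V : Type*} [Nonempty V] {G : I → V → ℝ} {C : ℝ}
    (hC : ∀ t x, G t x ≤ C) (h0 : ∀ x, G 0 x ≤ 0)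
    (hcont : ∀ ε > 0, ∃ η > 0, ∀ s t : I, |(t : ℝ) - s| < η → ∀ x, |G t x - G s x| ≤ ε)
    (hgrow : ∀ t : I, ∀ ε > 0, ∃ η > 0, ∀ h s : I, (t : ℝ) + h = s → (h : ℝ) < η →
      ∀ x, G s x ≤ (⨆ y, G t y) + ε * h) (t : I) (x : V) : G t x ≤ 0 := by
  have hbdd : ∀ t, BddAbove (range (G t)) := fun t => ⟨C, by rintro _ ⟨x, rfl⟩; exact hC t x⟩
  have h01 : (0 : ℝ) ≤ 1 := zero_le_one
  set D : ℝ → ℝ := fun τ => ⨆ x, G (projIcc 0 1 h01 τ) x with hD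
  have hproj : ∀ τ (hτ : τ ∈ Icc (0 : ℝ) 1), projIcc 0 1 h01 τ = ⟨τ, hτ⟩ := fun τ hτ =>
    projIcc_of_mem h01 hτ
  have hDle : ∀ {s t : I} {c : ℝ}, (∀ x, G t x ≤ G s x + c) → (⨆ x, G t x) ≤ (⨆ x, G s x) + c :=
    fun {s _ _} h => ciSup_le fun x => (h x).trans (by linarith [le_ciSup (hbdd s) x])
  have hDcont : ContinuousOn D (Icc 0 1) := by
    intro τ hτ
    rw [ContinuousWithinAt, Metric.tendsto_nhdsWithin_nhds]
    intro ε hε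
    obtain ⟨η, hη, h⟩ := hcont (ε / 2) (by positivity)
    refine ⟨η, hη, fun w hw hd => ?_⟩
    have h' := h ⟨τ, hτ⟩ ⟨w, hw⟩ (by simpa [Real.dist_eq] using hd)
    simp only [hD, hproj τ hτ, hproj w hw, Real.dist_eq]
    have e1 := hDle (s := ⟨τ, hτ⟩) (t := ⟨w, hw⟩) (c := ε / 2)
      fun x => by linarith [(abs_le.1 (h' x)).2]
    have e2 := hDle (s := ⟨w, hw⟩) (t := ⟨τ, hτ⟩) (c := ε / 2)
      fun x => by linarith [(abs_le.1 (h' x)).1]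
    exact abs_lt.2 ⟨by linarith, by linarith⟩
  -- Growth with `ε = r / 2` makes the slope strictly smaller than `r`, as the comparison with the
  -- constant `0` requires.
  have hDini : ∀ τ ∈ Ico (0 : ℝ) 1, ∀ r, (0 : ℝ) < r → ∃ᶠ z in 𝓝[>] τ, slope D τ z < r := by
    intro τ hτ r hr
    have hτ' : τ ∈ Icc (0 : ℝ) 1 := ⟨hτ.1, hτ.2.le⟩
    obtain ⟨η, hη, h⟩ := hgrow ⟨τ, hτ'⟩ (r / 2) (by positivity)
    have hev : ∀ᶠ z in 𝓝[>] τ, z ∈ Ioo τ (min 1 (τ + η)) :=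
      Ioo_mem_nhdsGT (lt_min hτ.2 (by linarith))
    refine (hev.mono fun z hz => ?_).frequently
    have hz1 : z < 1 := hz.2.trans_le (min_le_left _ _)
    have hz2 : z < τ + η := hz.2.trans_le (min_le_right _ _)
    have hz0 : τ < z := hz.1
    have hzI : z ∈ Icc (0 : ℝ) 1 := ⟨hτ.1.trans hz0.le, hz1.le⟩
    have h1 : D z ≤ D τ + r / 2 * (z - τ) := by
      simp only [hD, hproj τ hτ', hproj z hzI]
      exact ciSup_le (h ⟨z - τ, by linarith, by linarith [hτ.1]⟩ ⟨z, hzI⟩ (by simp)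
        (by change z - τ < η; linarith))
    rw [slope_def_field, div_lt_iff₀ (by linarith)]
    nlinarith
  have hD0 : D 0 ≤ 0 := by
    simp only [hD, hproj 0 ⟨le_rfl, h01⟩]
    exact ciSup_le h0
  have hDt := image_le_of_liminf_slope_right_le_deriv_boundary hDcont (B := fun _ => 0)
    (B' := fun _ => 0) hD0 continuousOn_const
    (fun x _ => hasDerivWithinAt_const x _ 0) hDini t.2
  simp only [hD, projIcc_val] at hDt
  exact (le_ciSup (hbdd t) x).trans hDt

variable {Ω' : Type*} {H' : Set (Ω' → ℝ)} {E' : (Ω' → ℝ) → ℝ} {X' : I → Ω' → Vec d}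

/-- Two nonlinear Lévy processes that have the same generator on smooth functions are
comparable. -/
theorem IsNonlinearLevy.transition_le_transition
    (hE : IsSublinearExpectationSpace H E) (hX : IsNonlinearLevy H E X)
    (hE' : IsSublinearExpectationSpace H' E') (hX' : IsNonlinearLevy H' E' X')
    (hc : IsContinuousAtZero E X) (hc' : IsContinuousAtZero E' X')
    (hgen : ∀ u : Vec d → ℝ, IsBddLip u → IsCb3 u → ∀ ε > 0, ∃ η > 0, ∀ r : I, (r : ℝ) < η →
      ∀ x, |transition E X r u x - transition E' X' r u x| ≤ ε * r)
    {f : Vec d → ℝ} (hf : IsBddLip f) (t : I) (x : Vec d) :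
    transition E' X' t f x ≤ transition E X t f x := by
  obtain ⟨C, K, hC0, hK0, hC, hK⟩ := hf.exists_bounds
  refine le_of_forall_pos_le_add fun ε hε => ?_
  -- With this width, mollifying a `K`-Lipschitz function costs at most `ε / 2`; it is paid once for
  -- `f` and once for `T_t f`.
  obtain ⟨ν, hν, hνε, hν3⟩ := exists_mollifier d (show 0 < ε / (2 * (K + 1)) by positivity)
  have hKε : K * (ε / (2 * (K + 1))) ≤ ε / 2 := by
    rw [mul_div_assoc', div_le_div_iff₀ (by positivity) (by positivity)]
    nlinarith
  set moll : (Vec d → ℝ) → Vec d → ℝ := fun g x => ∫ z, g (x - z) ∂ν with hmoll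
  have hmollL : ∀ {g : Vec d → ℝ}, IsBddLip g → IsBddLip (moll g) := fun hg => hg.integral_sub ν
  have hT : ∀ s, IsBddLip (transition E X s f) := fun s => hX.isBddLip_transition hE s hf
  have hT' : ∀ s {g}, IsBddLip g → IsBddLip (transition E' X' s g) := fun s _ hg =>
    hX'.isBddLip_transition hE' s hg
  have hg := hmollL hf
  set G : I → Vec d → ℝ := fun s y =>
    transition E' X' s (moll f) y - moll (transition E X s f) y with hG
  have hmb := hf.integral_sub_bounds hC hK ν
  have hGb : ∀ s y, G s y ≤ C + C := fun s y => by
    have h1 := (hX'.transition_bounds hE' s hg hmb.1 hmb.2).1 y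
    have hb := hX.transition_bounds hE s hf hC hK
    have h2 := ((hT s).integral_sub_bounds hb.1 hb.2 ν).1 y
    simp only [hG]
    linarith [(abs_le.1 h1).2, (abs_le.1 h2).1]
  have hbdd : ∀ s, BddAbove (range (G s)) := fun s => ⟨C + C, by
    rintro _ ⟨y, rfl⟩; exact hGb s y⟩
  have hGle : G t x ≤ 0 := by
    refine nonpos_of_iSup_growth hGb (fun y => ?_) (fun e he => ?_) (fun s e he => ?_) t x
    · simp only [hG, hX.transition_zero hE, hX'.transition_zero hE', sub_self, le_refl]
    · obtain ⟨η₁, hη₁, h₁⟩ := hc f hf (e / 2) (by positivity)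
      obtain ⟨η₂, hη₂, h₂⟩ := hc' (moll f) hg (e / 2) (by positivity)
      refine ⟨min η₁ η₂, lt_min hη₁ hη₂, fun s t hst y => ?_⟩
      have e1 := abs_integral_sub_le_of_abs_sub_le (hT t) (hT s) ν
        (hX.abs_transition_sub_transition_le hE hf h₁ (hst.trans_le (min_le_left _ _))) y
      have e2 := hX'.abs_transition_sub_transition_le hE' hg h₂
        (hst.trans_le (min_le_right _ _)) y
      simp only [hG, hmoll] at *
      have e1' := abs_le.1 e1
      have e2' := abs_le.1 e2
      exact abs_le.2 ⟨by linarith, by linarith⟩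
    · obtain ⟨η, hη, h⟩ := hgen (moll (transition E X s f)) (hmollL (hT s)) (hν3 _ (hT s)) e he
      refine ⟨η, hη, fun r q hq hr y => ?_⟩
      have hq' : (r : ℝ) + s = q := by rw [add_comm]; exact hq
      have e1 := hX'.transition_le_add hE' r (hT' s hg) (hmollL (hT s)) (c := ⨆ y, G s y)
        (fun z => by have := le_ciSup (hbdd s) z; simp only [hG] at this ⊢; linarith) y
      rw [← hX'.transition_add hq' hg] at e1
      have e2 := hX.transition_integral_sub_le hE r (hT s) ν hνε y
      rw [← hX.transition_add hq' hf] at e2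
      have e3 := (abs_le.1 (h r hr y)).1
      simp only [hG, hmoll] at *
      linarith
  have hb := hX.transition_bounds hE t hf hC hK
  have e1 := (abs_le.1 (abs_integral_sub_sub_le (hT t) hK0 hb.2 hνε x)).2
  have e2 := (abs_le.1 (hX'.abs_transition_sub_le hE' t hg hf
    (abs_integral_sub_sub_le hf hK0 hK hνε) x)).1
  simp only [hG, hmoll] at hGle
  linarith

end Comparison

/-! ### The generator of the limit processes -/

section Generator

variable {Ω : Type*} {d : ℕ} {H : Set (Ω → ℝ)} {E : (Ω → ℝ) → ℝ} {Z : ℕ → Ω → Vec d}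
  {α δ M : ℝ} {U : Ultrafilter ℕ}

theorem exists_mul_rpow_le (c : ℝ) {p : ℝ} (hp : 0 < p) {ε : ℝ} (hε : 0 < ε) :
    ∃ η > 0, ∀ r : ℝ, 0 ≤ r → r < η → c * r ^ p ≤ ε := by
  have h : Tendsto (fun r : ℝ => c * r ^ p) (𝓝 0) (𝓝 0) := by
    have := ((Real.continuousAt_rpow_const 0 p (Or.inr hp.le)).tendsto).const_mul c
    rwa [Real.zero_rpow hp.ne', mul_zero] at this
  obtain ⟨η, hη, h'⟩ := Metric.eventually_nhds_iff.1 (h.eventually_le_const hε)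
  exact ⟨η, hη, fun r h0 hr => h' (by rwa [Real.dist_eq, sub_zero, abs_of_nonneg h0])⟩

theorem floor_div_le (n : ℕ) (t : I) : (⌊(n : ℝ) * (t : ℝ)⌋₊ : ℝ) / n ≤ t := by
  refine div_le_of_le_mul₀ n.cast_nonneg t.2.1 ?_
  rw [mul_comm (t : ℝ)]
  exact Nat.floor_le (mul_nonneg n.cast_nonneg t.2.1)

theorem tendsto_floor_div (hU : (U : Filter ℕ) ≤ atTop) (t : I) :
    Tendsto (fun n : ℕ => (⌊(n : ℝ) * (t : ℝ)⌋₊ : ℝ) / n) U (𝓝 t) := by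
  have := ((tendsto_nat_floor_mul_div_atTop t.2.1).comp
    (tendsto_natCast_atTop_atTop (R := ℝ))).mono_left hU
  simpa only [Function.comp_def, mul_comm (t : ℝ)] using this

theorem IsIID.tendsto_transition (hE : IsSublinearExpectationSpace H E) (hZ : IsIID H E Z)
    (t : I) {f : Vec d → ℝ} (hf : IsBddLip f) (x : Vec d) :
    Tendsto (fun n : ℕ => E (fun ω => f (x + scaledSum α Z n ⌊(n : ℝ) * (t : ℝ)⌋₊ ω))) U
      (𝓝 (transition (limitExpectation E α Z U) (canonical (d := d)) t f x)) :=
  hZ.tendsto_limitExpectation_canonical hE t (φ := fun y => f (x + y)) (hf.comp_left x)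

/-- The bound `(⌊nr⌋/n)^{δ/α} ≤ r^{δ/α}` is uniform in `n` and `x`, so it survives the limit. -/
theorem HasMomentBound.isContinuousAtZero (hE : IsSublinearExpectationSpace H E)
    (hZ : IsIID H E Z) (hα : 0 < α) (hδ : 0 < δ) (hδ1 : δ ≤ 1) (hM : HasMomentBound E α Z δ M)
    (hU : (U : Filter ℕ) ≤ atTop) :
    IsContinuousAtZero (limitExpectation E α Z U) (canonical (d := d)) := by
  intro f hf ε hε
  obtain ⟨C, K, hC0, hK0, hC, hK⟩ := hf.exists_bounds
  obtain ⟨η, hη, h⟩ := exists_mul_rpow_le ((2 * C + K + 1) * M)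
    (show 0 < δ / α by positivity) hε
  have hM0 := hM.nonneg hE
  refine ⟨η, hη, fun r hr x => ?_⟩
  refine le_of_tendsto (((hZ.tendsto_transition (α := α) (U := U) hE r hf x).sub_const
    (f x)).abs) ?_
  filter_upwards [hU (eventually_ge_atTop 1)] with n hn
  refine (hM.abs_map_sub_le hE hZ hα hδ hδ1 hn _ hC0 hK0 hC hK x).trans
    (le_trans ?_ (h r r.2.1 hr))
  gcongr
  exact floor_div_le n r

/-- A one-step expansion of the expectation iterates to a `k`-step expansion. -/
theorem IsIID.abs_map_scaledSum_expansion_le (hE : IsSublinearExpectationSpace H E)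
    (hZ : IsIID H E Z) (α : ℝ) (n : ℕ) {u g : Vec d → ℝ} (hu : IsBddLip u) (hg : IsBddLip g)
    {e κ : ℝ} (hstep : ∀ x, |E (fun ω => u (x + scaledSum α Z n 1 ω)) - u x - 1 / n * g x| ≤
      1 / n * e) (k : ℕ)
    (hκ : ∀ j < k, ∀ x, |E (fun ω => g (x + scaledSum α Z n j ω)) - g x| ≤ κ)
    (hκ' : ∀ j < k, ∀ x, |E (fun ω => -g (x + scaledSum α Z n j ω)) - -g x| ≤ κ) (x : Vec d) :
    |E (fun ω => u (x + scaledSum α Z n k ω)) - u x - (k : ℝ) / n * g x| ≤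
      (k : ℝ) / n * (e + κ) := by
  induction k with
  | zero => simp [scaledSum, hE.const]
  | succ k ih =>
    have ih := abs_le.1 (ih (fun j hj => hκ j (hj.trans k.lt_succ_self))
      fun j hj => hκ' j (hj.trans k.lt_succ_self))
    have h1 := abs_le.1 (hκ k k.lt_succ_self x)
    have h2 := abs_le.1 (hκ' k k.lt_succ_self x)
    have hX := hZ.isRandomVariable_scaledSum hE α n
    set w : Vec d → ℝ := fun y => E (fun ω => u (y + scaledSum α Z n 1 ω)) with hw_def
    have hw : IsBddLip w :=
      hE.isBddLip_map_prod (φ := fun p : Vec d × Vec d => u (p.1 + p.2)) (hX 1)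
        (hu.comp (LipschitzWith.prod_fst.add LipschitzWith.prod_snd))
    have hadd : E (fun ω => u (x + scaledSum α Z n (k + 1) ω)) =
        E (fun ω => w (x + scaledSum α Z n k ω)) := by
      have := hZ.map_scaledSum_add hE α n k 1 (hu.comp_left x)
      simpa only [hw_def, add_assoc] using this
    have hn : (0 : ℝ) ≤ 1 / n := by positivity
    have mw := hX k _ (hw.comp_left x)
    have mu := hX k _ (hu.comp_left x)
    have mg := hX k _ (hg.comp_left x)
    have mg' := hX k _ (hg.neg.comp_left x)
    -- As `E` is not linear, the upper estimate involves `E[g]` and the lower one `-E[-g]`; hence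
    -- the two hypotheses on `g` and `-g`.
    have up := hE.map_le_map_add mw mu (hE.add_mem _ (hE.smul_mem (1 / n) _ mg) _
      (hE.const_mem (1 / n * e))) fun ω => by
        have := (abs_le.1 (hstep (x + scaledSum α Z n k ω))).2
        simp only [hw_def] at this ⊢; linarith
    have lo := hE.map_le_map_add mu mw (hE.add_mem _ (hE.smul_mem (1 / n) _ mg') _
      (hE.const_mem (1 / n * e))) fun ω => by
        have := (abs_le.1 (hstep (x + scaledSum α Z n k ω))).1
        simp only [hw_def] at this ⊢; linarith
    rw [hE.map_add_const (hE.smul_mem (1 / n) _ mg), hE.map_const_mul mg hn] at up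
    rw [hE.map_add_const (hE.smul_mem (1 / n) _ mg'), hE.map_const_mul mg' hn] at lo
    have h1' := mul_le_mul_of_nonneg_left h1.2 hn
    have h2' := mul_le_mul_of_nonneg_left h2.2 hn
    have hk : ((k + 1 : ℕ) : ℝ) / n = (k : ℝ) / n + 1 / n := by push_cast; ring
    rw [hadd, hk]
    exact abs_le.2 ⟨by linarith, by linarith⟩

/-- Under the consistency condition every smooth function has a generator, up to any error, which
is common to all limit processes. -/
theorem ConsistencyCondition.exists_generator (hE : IsSublinearExpectationSpace H E)
    (hZ : IsIID H E Z) (hα : 0 < α) (hδ : 0 < δ) (hδ1 : δ ≤ 1) (hM : HasMomentBound E α Z δ M)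
    {Λ₁ Λ₂ : ℝ} (hcons : ConsistencyCondition E α Λ₁ Λ₂ (Z 0)) {u : Vec d → ℝ}
    (hu : IsBddLip u) (hu3 : IsCb3 u) {ε : ℝ} (hε : 0 < ε) :
    ∃ (g : Vec d → ℝ) (η : ℝ), 0 < η ∧ ∀ U : Ultrafilter ℕ, (U : Filter ℕ) ≤ atTop →
      ∀ r : I, (r : ℝ) < η → ∀ x,
        |transition (limitExpectation E α Z U) (canonical (d := d)) r u x - u x - r * g x| ≤
          r * ε := by
  obtain ⟨l, hl, hbound⟩ := hcons u hu3
  have hM0 := hM.nonneg hE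
  have hl' : ∀ᶠ s in 𝓝[>] (0 : ℝ), l s ≤ ε / 8 := hl.eventually_le_const (by positivity)
  obtain ⟨b, hb0, hb⟩ := mem_nhdsGT_iff_exists_Ioc_subset.1 hl'
  rw [mem_Ioi] at hb0
  set s₁ := min b 1
  have hs₁ : 0 < s₁ := lt_min hb0 one_pos
  set Δ : ℝ → Vec d → ℝ := fun s x => E (fun ω => u (x + s ^ (1 / α) • Z 0 ω) - u x) with hΔ
  have hmem : ∀ (s : ℝ) x, (fun ω => u (x + s ^ (1 / α) • Z 0 ω)) ∈ H := fun s x =>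
    hZ.randomVariable 0 _ ((hu.comp_left x).comp (lipschitzWith_smul_vec _))
  have hΔeq : ∀ s x, Δ s x = E (fun ω => u (x + s ^ (1 / α) • Z 0 ω)) - u x := fun s x =>
    hE.map_sub_const (hmem s x) _
  have hΔL : ∀ s ∈ Ioc 0 s₁, ∀ x, |Δ s x - s * jumpGenerator α Λ₁ Λ₂ u x| ≤ s * (ε / 8) := by
    intro s hs x
    have h1 := hbound s ⟨hs.1, hs.2.trans (min_le_right _ _)⟩ x
    have h2 : l s ≤ ε / 8 := hb ⟨hs.1, hs.2.trans (min_le_left _ _)⟩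
    rw [one_div, inv_mul_le_iff₀ hs.1] at h1
    exact h1.trans (mul_le_mul_of_nonneg_left h2 hs.1.le)
  -- A difference quotient at one fixed small step replaces the jump generator: it is visibly
  -- bounded Lipschitz and within `ε / 8` of it, so no regularity of the generator is needed.
  set g : Vec d → ℝ := fun x => s₁⁻¹ * Δ s₁ x with hg_def
  have hg : IsBddLip g := by
    have h1 : IsBddLip (fun x => E (fun ω => u (x + s₁ ^ (1 / α) • Z 0 ω))) :=
      hE.isBddLip_map_prod (φ := fun p : Vec d × Vec d => u (p.1 + s₁ ^ (1 / α) • p.2))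
        (hZ.randomVariable 0) (hu.comp (LipschitzWith.prod_fst.add
          ((lipschitzWith_smul_vec _).comp LipschitzWith.prod_snd)))
    have h2 := (h1.sub hu).const_mul s₁⁻¹
    simpa only [hg_def, hΔeq] using h2
  have hgL : ∀ x, |g x - jumpGenerator α Λ₁ Λ₂ u x| ≤ ε / 8 := by
    intro x
    have h1 := hΔL s₁ ⟨hs₁, le_rfl⟩ x
    have h2 : Δ s₁ x = s₁ * g x := by rw [hg_def]; field_simp
    rw [h2, ← mul_sub, abs_mul, abs_of_pos hs₁] at h1
    exact le_of_mul_le_mul_left h1 hs₁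
  have hstep : ∀ s ∈ Ioc 0 s₁, ∀ x,
      |E (fun ω => u (x + s ^ (1 / α) • Z 0 ω)) - u x - s * g x| ≤ s * (ε / 4) := by
    intro s hs x
    rw [← hΔeq]
    have h1 := abs_le.1 (hΔL s hs x)
    have h2 := abs_le.1 (hgL x)
    have h3 := mul_le_mul_of_nonneg_left h2.1 hs.1.le
    have h4 := mul_le_mul_of_nonneg_left h2.2 hs.1.le
    exact abs_le.2 ⟨by linarith, by linarith⟩
  obtain ⟨C, K, hC0, hK0, hC, hK⟩ := hg.exists_bounds
  -- Up to time `η` the walk moves the expectations of `g` and `-g` by at most `ε / 4`.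
  obtain ⟨η, hη, hηle⟩ := exists_mul_rpow_le ((2 * C + K + 1) * M)
    (show 0 < δ / α by positivity) (show 0 < ε / 4 by positivity)
  refine ⟨g, η, hη, fun U hU r hr x => ?_⟩
  have hlim := ((hZ.tendsto_transition (α := α) (U := U) hE r hu x).sub_const (u x)).sub
    ((tendsto_floor_div hU r).mul_const (g x))
  refine le_of_tendsto_of_tendsto hlim.abs ((tendsto_floor_div hU r).mul_const ε) ?_
  -- For `n ≥ 1/s₁` the step `s = 1/n` is admissible, and `s^{1/α} Z 0` is one step of the scaled
  -- walk.
  obtain ⟨N, hN⟩ := exists_nat_ge s₁⁻¹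
  filter_upwards [hU (eventually_ge_atTop 1), hU (eventually_ge_atTop N)] with n hn hnN
  have hn0 : (0 : ℝ) < n := by exact_mod_cast hn
  have hns : (1 : ℝ) / n ∈ Ioc 0 s₁ := by
    refine ⟨by positivity, ?_⟩
    rw [one_div]
    refine inv_le_of_inv_le₀ hs₁ (hN.trans ?_)
    exact_mod_cast hnN
  have hpow : ((1 : ℝ) / n) ^ (1 / α) = (n : ℝ) ^ (-(1 / α)) := by
    rw [one_div, Real.inv_rpow hn0.le, Real.rpow_neg hn0.le]
  have hs1 : ∀ ω, ((1 : ℝ) / n) ^ (1 / α) • Z 0 ω = scaledSum α Z n 1 ω := fun ω => by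
    rw [hpow]; simp [scaledSum]
  have hst := hstep _ hns
  simp only [hs1] at hst
  have hsmall : ∀ j < ⌊(n : ℝ) * (r : ℝ)⌋₊,
      (2 * C + K + 1) * M * ((j : ℝ) / n) ^ (δ / α) ≤ ε / 4 := by
    intro j hj
    refine le_trans ?_ (hηle r r.2.1 hr)
    gcongr
    refine le_trans ?_ (floor_div_le n r)
    gcongr
  have hexp := hZ.abs_map_scaledSum_expansion_le hE α n hu hg hst ⌊(n : ℝ) * (r : ℝ)⌋₊
    (κ := ε / 4)
    (fun j hj y => (hM.abs_map_sub_le hE hZ hα hδ hδ1 hn j hC0 hK0 hC hK y).trans (hsmall j hj))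
    (fun j hj y => (hM.abs_map_sub_le (f := fun y => -g y) hE hZ hα hδ hδ1 hn j hC0 hK0
      (fun y => by rw [abs_neg]; exact hC y)
      (fun y z => by rw [neg_sub_neg, abs_sub_comm]; exact hK y z) y).trans (hsmall j hj)) x
  refine hexp.trans (mul_le_mul_of_nonneg_left (by linarith) (by positivity))

/-- Under the consistency condition the limit law does not depend on the ultrafilter. -/
theorem ConsistencyCondition.limitExpectation_le (hE : IsSublinearExpectationSpace H E)
    (hZ : IsIID H E Z) (hα : 0 < α) (hδ : 0 < δ) (hδ1 : δ ≤ 1) (hM : HasMomentBound E α Z δ M)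
    {Λ₁ Λ₂ : ℝ} (hcons : ConsistencyCondition E α Λ₁ Λ₂ (Z 0)) {U U' : Ultrafilter ℕ}
    (hU : (U : Filter ℕ) ≤ atTop) (hU' : (U' : Filter ℕ) ≤ atTop) {f : Vec d → ℝ}
    (hf : IsBddLip f) :
    limitExpectation E α Z U' (fun ω => f (canonical 1 ω)) ≤
      limitExpectation E α Z U (fun ω => f (canonical 1 ω)) := by
  have := (hZ.isNonlinearLevy_limitExpectation hE hα hδ hδ1 hM hU).transition_le_transition
    (hZ.sublinear_limitExpectation hE α U) (hZ.sublinear_limitExpectation hE α U')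
    (hZ.isNonlinearLevy_limitExpectation hE hα hδ hδ1 hM hU')
    (hM.isContinuousAtZero hE hZ hα hδ hδ1 hU) (hM.isContinuousAtZero hE hZ hα hδ hδ1 hU')
    (fun u hu hu3 ε hε => by
      obtain ⟨g, η, hη, h⟩ := hcons.exists_generator hE hZ hα hδ hδ1 hM hu hu3
        (show 0 < ε / 2 by positivity)
      refine ⟨η, hη, fun r hr x => ?_⟩
      have h1 := abs_le.1 (h U hU r hr x)
      have h2 := abs_le.1 (h U' hU' r hr x)
      exact abs_le.2 ⟨by linarith, by linarith⟩) hf 1 0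
  simpa only [transition, zero_add] using this

/-- A sequence converges as soon as it has the same limit along every ultrafilter finer than
`atTop`. Only ultrafilter limits are compared, so part 2, whose hypothesis concerns arbitrary Lévy
limits, is bypassed. -/
theorem ConsistencyCondition.exists_levyLimit (hE : IsSublinearExpectationSpace H E)
    (hZ : IsIID H E Z) (hα : 0 < α) (hδ : 0 < δ) (hδ1 : δ ≤ 1) (hM : HasMomentBound E α Z δ M)
    {Λ₁ Λ₂ : ℝ} (hcons : ConsistencyCondition E α Λ₁ Λ₂ (Z 0)) :
    ∃ E' : (PathSpace d → ℝ) → ℝ, IsLevyLimitAlong E α Z id E' := by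
  have hU := Nat.hyperfilter_le_atTop
  refine ⟨limitExpectation E α Z (hyperfilter ℕ), hZ.sublinear_limitExpectation hE α _,
    hZ.isNonlinearLevy_limitExpectation hE hα hδ hδ1 hM hU, fun φ hφ => ?_⟩
  rw [tendsto_iff_ultrafilter]
  intro U' hU'
  rw [(hcons.limitExpectation_le hE hZ hα hδ hδ1 hM hU' hU hφ).antisymm
    (hcons.limitExpectation_le hE hZ hα hδ hδ1 hM hU hU' hφ)]
  exact hZ.tendsto_limitExpectation_one hE hφ

end Generator

end RobustStable

open RobustStable in
theorem theorem4p1 {Ω : Type*} {d : ℕ} (H : Set (Ω → ℝ)) (E : (Ω → ℝ) → ℝ)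
    (hE : IsSublinearExpectationSpace H E) (α : ℝ) (hα : α ∈ Set.Ioc (0 : ℝ) 1)
    (Z : ℕ → Ω → Vec d) (hZ : IsIID H E Z) (hA1 : MomentCondition E α Z) :
    -- every subsequence of the normalized sums has a further subsequence with a Lévy limit
    (∀ k : ℕ → ℕ, StrictMono k → ∃ j : ℕ → ℕ, StrictMono j ∧
      ∃ E' : (PathSpace d → ℝ) → ℝ, IsLevyLimitAlong E α Z (k ∘ j) E') ∧
    -- if the law of the limit is unique, the whole sequence converges
    ((∀ (k₁ k₂ : ℕ → ℕ) (E₁ E₂ : (PathSpace d → ℝ) → ℝ), StrictMono k₁ → StrictMono k₂ →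
        IsLevyLimitAlong E α Z k₁ E₁ → IsLevyLimitAlong E α Z k₂ E₂ →
        SameLaw E₁ (canonical (d := d) 1) E₂ (canonical (d := d) 1)) →
      ∃ E' : (PathSpace d → ℝ) → ℝ, IsLevyLimitAlong E α Z id E') ∧
    -- under the consistency condition the whole sequence converges
    (∀ Λ₁ Λ₂ : ℝ, 0 < Λ₁ → Λ₁ < Λ₂ → ConsistencyCondition E α Λ₁ Λ₂ (Z 0) →
      ∃ E' : (PathSpace d → ℝ) → ℝ, IsLevyLimitAlong E α Z id E') := by
  obtain ⟨δ, M, hδ, hδα, hM⟩ := hA1.exists_hasMomentBound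
  -- The bound `α ≤ 1` enters only here.
  have hδ1 : δ ≤ 1 := hδα.le.trans hα.2
  have hsub : ∀ k : ℕ → ℕ, StrictMono k → ∃ j : ℕ → ℕ, StrictMono j ∧
      ∃ E' : (PathSpace d → ℝ) → ℝ, IsLevyLimitAlong E α Z (k ∘ j) E' :=
    fun _ hk => hZ.exists_levyLimit_subseq hE hα.1 hδ hδ1 hM hk
  exact ⟨hsub, exists_levyLimit_of_unique hsub,
    fun _ _ _ _ hcons => hcons.exists_levyLimit hE hZ hα.1 hδ hδ1 hM⟩
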